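/- Let $h\ge 1$ and let $\mathbf Q=(q_{ij})$ be an $h\times h$ generator matrix, i.e. $0\le q_{ij}<\infty$ for $i\ne j$, $q_{ii}\le 0$ and $\sum_{j}q_{ij}=0$ for all $i$. Rows may vanish and the chain may be reducible, so absorbing states are allowed. Let $(X(t))_{t\ge 0}$ be a right-continuous continuous-time Markov chain on $\{1,\dots,h\}$ with generator $\mathbf Q$, that is, with transition matrices $e^{\mathbf Q t}$, and with an arbitrary initial distribution. For $\alpha,\beta\in\{1,\dots,h\}$ let $\mathbf e_\alpha\in\mathbb R^h$ denote the standard basis (column) vectors and define the $2h\times 2h$ matrices $$\mathbf C^{(\alpha\beta)}_\gamma=\begin{pmatrix}\mathbf Q & q_{\alpha\beta}\,\mathbf e_\alpha\mathbf e_\beta^{\top}\\ 0&\mathbf Q\end{pmatrix},\qquad \mathbf C^{(\alpha)}_\phi=\begin{pmatrix}\mathbf Q & \mathbf e_\alpha\mathbf e_\alpha^{\top}\\ 0&\mathbf Q\end{pmatrix}.$$ Let $n\ge 1$, let $0\le t_1<t_2<\dots<t_n$, and let $y=(y_1,\dots,y_n)\in\{1,\dots,h\}^n$ be observed states with $\mathbb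 P(X(t_1)=y_1,\dots,X(t_n)=y_n)>0$. Write $K_{ij}$ for the number of jumps of $X$ from $i$ to $j$ in the observation window $(t_1,t_n]$ and $S_i$ for the time that $X$ spends in state $i$ during $[t_1,t_n]$. Write $\mathbb E_{\mathbf Q}[\,\cdot\mid y]$ for the expectation conditional on the event $\{X(t_s)=y_s,\ s=1,\dots,n\}$. Then $\left(e^{\mathbf Q(t_{s+1}-t_s)}\right)_{y_s,y_{s+1}}>0$ for $s=1,\dots,n-1$, the random variables $K_{ij}$ ($i\neq j$) and $S_i$ have finite conditional expectations, and $$\mathbb E_{\mathbf Q}[K_{ij}\mid y]=\sum_{s=1}^{n-1}\frac{\left(\exp\{\mathbf C^{(ij)}_\gamma(t_{s+1}-t_s)\}\right)_{y_s,\,h+y_{s+1}}}{\left(\exp\{\mathbf Q(t_{s+1}-t_s)\}\right)_{y_s,\,y_{s+1}}}\qquad\text{for all } i\ne j,$$ $$\mathbb E_{\mathbf Q}[S_i\mid y]=\sum_{s=1}^{n-1}\frac{\left(\exp\{\mathbf C^{(i)}_\phi(t_{s+1}-t_s)\}\right)_{y_s,\,h+y_{s+1}}}{\left(\exp\{\mathbf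 Q(t_{s+1}-t_s)\}\right)_{y_s,\,y_{s+1}}}\qquad\text{for all } i.$$ -/

import Mathlib

open MeasureTheory ProbabilityTheory Topology
open scoped NNReal ENNReal

noncomputable section

/-- `Q` is a (stable, conservative) generator matrix on the state space `Fin h`. Absorbing states
(zero rows) and reducible chains are allowed. -/
structure IsGenerator {h : ℕ} (Q : Matrix (Fin h) (Fin h) ℝ) : Prop where
  off_diag_nonneg : ∀ i j, i ≠ j → 0 ≤ Q i j
  diag_nonpos : ∀ i, Q i i ≤ 0
  row_sum : ∀ i, ∑ j, Q i j = 0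

/-- The transition matrix `P(r) = exp (r Q)`. -/
def transitionMatrix {h : ℕ} (Q : Matrix (Fin h) (Fin h) ℝ) (r : ℝ) : Matrix (Fin h) (Fin h) ℝ :=
  NormedSpace.exp (r • Q)

/-- `X` is a (time-homogeneous, right-continuous) continuous-time Markov chain with generator `Q`
under `μ`, with arbitrary initial law: its finite-dimensional distributions are those of the Markov
chain with transition matrices `exp (r Q)`. Right-continuity is with respect to the discrete
topology of `Fin h`, and is only asked for almost surely. -/
structure IsCTMC {Ω : Type*} [MeasurableSpace Ω] (μ : Measure Ω) {h : ℕ}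
    (Q : Matrix (Fin h) (Fin h) ℝ) (X : ℝ≥0 → Ω → Fin h) : Prop where
  measurable : ∀ u, Measurable (X u)
  right_continuous : ∀ᵐ ω ∂μ, ∀ u, ContinuousWithinAt (fun v => X v ω) (Set.Ici u) u
  markov : ∀ (m : ℕ) (τ : Fin (m + 1) → ℝ≥0), StrictMono τ → ∀ x : Fin (m + 1) → Fin h,
    μ.real {ω | ∀ k, X (τ k) ω = x k} =
      μ.real {ω | X (τ 0) ω = x 0} *
        ∏ k : Fin m, transitionMatrix Q ((τ k.succ : ℝ) - τ k.castSucc) (x k.castSucc) (x k.succ)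

/-- The number (possibly `∞`) of jumps from `i` to `j` that the path `X · ω` makes in the time
interval `(a, b]`: the number of times `u` with `X (u-) = i` and `X u = j`. As there is no jump at
time `0`, the number of jumps in `[0, t]` is `jumpCount X i j 0 t ω`. For `i = j` this does not count
jumps. -/
def jumpCount {Ω : Type*} {h : ℕ} (X : ℝ≥0 → Ω → Fin h) (i j : Fin h) (a b : ℝ≥0) (ω : Ω) : ℝ≥0∞ :=
  ({u : ℝ≥0 | u ∈ Set.Ioc a b ∧ (∀ᶠ v in 𝓝[<] u, X v ω = i) ∧ X u ω = j}.encard : ℝ≥0∞)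

/-- The time that the path `X · ω` spends in state `i` during the time interval `[a, b]`
(Lebesgue measure of the set of such times; `u.toNNReal = u` there). -/
def holdingTime {Ω : Type*} {h : ℕ} (X : ℝ≥0 → Ω → Fin h) (i : Fin h) (a b : ℝ≥0) (ω : Ω) : ℝ≥0∞ :=
  volume {u : ℝ | u ∈ Set.Icc (a : ℝ) b ∧ X u.toNNReal ω = i}

/-- The `2h × 2h` block matrix `[Q, q_{αβ} e_α e_βᵀ; 0, Q]`. The row `k` is `Sum.inl k` and
the column `h + k` is `Sum.inr k`. -/
def Cgamma {h : ℕ} (Q : Matrix (Fin h) (Fin h) ℝ) (α β : Fin h) :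
    Matrix (Fin h ⊕ Fin h) (Fin h ⊕ Fin h) ℝ :=
  Matrix.fromBlocks Q (Q α β • Matrix.vecMulVec (Pi.single α 1) (Pi.single β 1)) 0 Q

/-- The `2h × 2h` block matrix `[Q, e_α e_αᵀ; 0, Q]`. -/
def Cphi {h : ℕ} (Q : Matrix (Fin h) (Fin h) ℝ) (α : Fin h) :
    Matrix (Fin h ⊕ Fin h) (Fin h ⊕ Fin h) ℝ :=
  Matrix.fromBlocks Q (Matrix.vecMulVec (Pi.single α 1) (Pi.single α 1)) 0 Q

end

open Filter

/-! Cut an observation interval of length `T` into `2^k` equal pieces. Replace the jump count by the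
number of pieces with endpoint values `i` and `j`, and the holding time by the mesh times the number
of pieces that start in `i`. By the Markov property, the integral of such a sum over the observation
event is a constant `C` times an entry of the upper right block of `M_k ^ 2^k`, where `M_k = [P, w ∘
P; 0, P]`, `P = exp (T Q / 2^k)` and `w ∘ P` is an entrywise product
(`setLIntegral_dyadicFunctional`, `fromBlocks_weightedTransition`). Since `2^k (M_k - 1)` tends to
`T [Q, V; 0, Q]`, with `V` the corner block of `Cgamma` or `Cphi`, these powers tend to `exp (T [Q,
V; 0, Q])` (`tendsto_weightedTransition`).

Pathwise, the number of pieces whose endpoint values differ increases with `k` and has bounded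
expectation, so its supremum is integrable (`exists_integrable_bound_switchCount`). Almost surely it
is therefore eventually constant in `k`; right-continuity then forces the path to be constant or to
switch exactly once on each piece. Hence the sums converge to the jump count and the holding time,
and dominated convergence identifies the integrals. The observation event itself has probability `C`
times the transition probability over the interval, so `C` cancels on conditioning; summing over the
intervals finishes the proof. -/

/-! ### Exponentials as limits of `2^k`-th powers. -/

theorem norm_pow_sub_pow_le_mul_pow {A : Type*} [NormedRing A] [NormOneClass A] {a b : A} {M : ℝ}
    (hM : 1 ≤ M) (ha : ‖a‖ ≤ M) (hb : ‖b‖ ≤ M) (n : ℕ) :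
    ‖a ^ n - b ^ n‖ ≤ n * M ^ n * ‖a - b‖ := by
  induction n with
  | zero => simp
  | succ n ih =>
    have h0 : (0 : ℝ) ≤ M := by linarith
    have e : a ^ (n + 1) - b ^ (n + 1) = a ^ n * (a - b) + (a ^ n - b ^ n) * b := by
      rw [pow_succ, pow_succ]; noncomm_ring
    have h1 : ‖a ^ n * (a - b)‖ ≤ M ^ (n + 1) * ‖a - b‖ := by
      refine (norm_mul_le _ _).trans ?_
      gcongr
      exact (norm_pow_le a n).trans ((pow_le_pow_left₀ (norm_nonneg _) ha n).trans
        (pow_le_pow_right₀ hM n.le_succ))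
    have h2 : ‖(a ^ n - b ^ n) * b‖ ≤ n * M ^ (n + 1) * ‖a - b‖ := by
      refine (norm_mul_le _ _).trans ((mul_le_mul ih hb (norm_nonneg _) (by positivity)).trans ?_)
      exact le_of_eq (by ring)
    rw [e]
    refine (norm_add_le _ _).trans ((add_le_add h1 h2).trans ?_)
    push_cast
    exact le_of_eq (by ring)

theorem tendsto_two_pow_smul_exp_sub_one {A : Type*} [NormedRing A] [NormedAlgebra ℝ A]
    [CompleteSpace A] (B : A) (T : ℝ) :
    Tendsto (fun k : ℕ => (2 ^ k : ℝ) • (NormedSpace.exp ((T / 2 ^ k) • B) - 1)) atTop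
      (𝓝 (T • B)) := by
  have h := (hasDerivAt_exp_smul_const (𝕂 := ℝ) (T • B) (0 : ℝ)).tendsto_slope_zero
  simp only [zero_smul, NormedSpace.exp_zero, one_mul, zero_add] at h
  have h2 : Tendsto (fun k : ℕ => ((2 ^ k : ℝ))⁻¹) atTop (𝓝[≠] 0) := by
    refine tendsto_nhdsWithin_iff.2 ⟨?_, Eventually.of_forall fun k => by simp⟩
    exact tendsto_inv_atTop_zero.comp (tendsto_pow_atTop_atTop_of_one_lt one_lt_two)
  refine (h.comp h2).congr fun k => ?_
  simp [smul_smul, div_eq_inv_mul]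

/-- Compare `a k` with `b k = exp (B / 2^k)`, whose `2^k`-th power is exactly `exp B`. Both have
norm at most `exp (K / 2^k)`, so the powers differ by at most `exp K * 2^k * ‖a k - b k‖`, which
tends to `0`. -/
theorem tendsto_pow_two_pow_exp {A : Type*} [NormedRing A] [NormedAlgebra ℝ A] [NormOneClass A]
    [CompleteSpace A] (a : ℕ → A) (B : A)
    (h : Tendsto (fun k : ℕ => (2 ^ k : ℝ) • (a k - 1)) atTop (𝓝 B)) :
    Tendsto (fun k => a k ^ 2 ^ k) atTop (𝓝 (NormedSpace.exp B)) := by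
  let : NormedAlgebra ℚ A := NormedAlgebra.restrictScalars ℚ ℝ A
  set b : ℕ → A := fun k => NormedSpace.exp (((1 : ℝ) / 2 ^ k) • B) with hb
  have hbB := tendsto_two_pow_smul_exp_sub_one B 1
  rw [one_smul] at hbB
  have hpow : ∀ k, b k ^ 2 ^ k = NormedSpace.exp B := fun k => by
    rw [hb, ← NormedSpace.exp_nsmul, ← Nat.cast_smul_eq_nsmul ℝ, smul_smul]
    simp
  obtain ⟨K, hK⟩ : ∃ K : ℝ, 0 ≤ K ∧ ∀ k, 2 ^ k * ‖a k - 1‖ ≤ K ∧ 2 ^ k * ‖b k - 1‖ ≤ K := by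
    obtain ⟨K₁, h₁⟩ := h.norm.bddAbove_range
    obtain ⟨K₂, h₂⟩ := hbB.norm.bddAbove_range
    refine ⟨max 0 (max K₁ K₂), le_max_left _ _, fun k => ⟨?_, ?_⟩⟩
    · refine le_trans ?_ ((h₁ ⟨k, rfl⟩).trans ((le_max_left _ _).trans (le_max_right _ _)))
      simp [norm_smul]
    · refine le_trans ?_ ((h₂ ⟨k, rfl⟩).trans ((le_max_right _ _).trans (le_max_right _ _)))
      simp [norm_smul, hb]
  have bound : ∀ (c : A) (k : ℕ), 2 ^ k * ‖c - 1‖ ≤ K → ‖c‖ ≤ Real.exp (K / 2 ^ k) := by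
    intro c k hc
    have h1 : ‖c‖ ≤ ‖c - 1‖ + 1 := by
      have := norm_add_le (c - 1) 1
      simpa using this
    have h2 : ‖c - 1‖ ≤ K / 2 ^ k := by
      rw [le_div_iff₀ (by positivity)]; linarith
    linarith [Real.add_one_le_exp (K / 2 ^ k)]
  have hle : ∀ k, ‖a k ^ 2 ^ k - NormedSpace.exp B‖ ≤
      Real.exp K * ‖(2 ^ k : ℝ) • (a k - 1) - (2 ^ k : ℝ) • (b k - 1)‖ := by
    intro k
    have := norm_pow_sub_pow_le_mul_pow (Real.one_le_exp (div_nonneg hK.1 (by positivity)))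
      (bound _ k (hK.2 k).1) (bound _ k (hK.2 k).2) (2 ^ k)
    rw [hpow, ← Real.exp_nat_mul] at this
    refine this.trans (le_of_eq ?_)
    rw [← smul_sub, norm_smul]
    have e : ((2 ^ k : ℕ) : ℝ) * (K / 2 ^ k) = K := by push_cast; field_simp
    rw [e, sub_sub_sub_cancel_right]
    simp
    ring
  rw [tendsto_iff_norm_sub_tendsto_zero]
  refine squeeze_zero (fun _ => norm_nonneg _) hle ?_
  have := ((h.sub hbB).norm).const_mul (Real.exp K)
  simpa [hb] using this

namespace Matrix

theorem tendsto_two_pow_smul_exp_sub_one {n : Type*} [Fintype n] [DecidableEq n]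
    (B : Matrix n n ℝ) (T : ℝ) :
    Tendsto (fun k : ℕ => (2 ^ k : ℝ) • (NormedSpace.exp ((T / 2 ^ k) • B) - 1)) atTop
      (𝓝 (T • B)) := by
  open scoped Norms.Operator in
  exact _root_.tendsto_two_pow_smul_exp_sub_one B T

/-- Only the entrywise topology occurs in the statement, so the norm may be chosen in the proof.
`Nonempty n` gives `‖1‖ = 1`. -/
theorem tendsto_pow_two_pow_exp {n : Type*} [Fintype n] [DecidableEq n] [Nonempty n]
    (a : ℕ → Matrix n n ℝ) (B : Matrix n n ℝ)
    (h : Tendsto (fun k : ℕ => (2 ^ k : ℝ) • (a k - 1)) atTop (𝓝 B)) :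
    Tendsto (fun k => a k ^ 2 ^ k) atTop (𝓝 (NormedSpace.exp B)) := by
  open scoped Norms.Operator in
  have : NormOneClass (Matrix n n ℝ) := Matrix.linfty_opNormOneClass
  exact _root_.tendsto_pow_two_pow_exp a B h

end Matrix

/-! ### Transition matrices and the block matrix limit. -/

section TransitionMatrix

variable {h : ℕ} (Q : Matrix (Fin h) (Fin h) ℝ)

@[simp]
theorem transitionMatrix_zero : transitionMatrix Q 0 = 1 := by
  simp [transitionMatrix]

theorem transitionMatrix_add (s t : ℝ) :
    transitionMatrix Q (s + t) = transitionMatrix Q s * transitionMatrix Q t := by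
  rw [transitionMatrix, add_smul]
  exact Matrix.exp_add_of_commute _ _ (((Commute.refl Q).smul_left s).smul_right t)

theorem tendsto_two_pow_mul_transitionMatrix_sub (T : ℝ) (i j : Fin h) :
    Tendsto (fun k : ℕ => 2 ^ k * (transitionMatrix Q (T / 2 ^ k) i j - (1 : Matrix _ _ ℝ) i j))
      atTop (𝓝 (T * Q i j)) := by
  have := Matrix.tendsto_two_pow_smul_exp_sub_one Q T
  exact tendsto_pi_nhds.1 (tendsto_pi_nhds.1 this i) j

theorem tendsto_transitionMatrix_div_two_pow (T : ℝ) (i j : Fin h) :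
    Tendsto (fun k : ℕ => transitionMatrix Q (T / 2 ^ k) i j) atTop
      (𝓝 ((1 : Matrix _ _ ℝ) i j)) := by
  have h1 : Tendsto (fun k : ℕ => ((2 ^ k : ℝ))⁻¹) atTop (𝓝 0) :=
    tendsto_inv_atTop_zero.comp (tendsto_pow_atTop_atTop_of_one_lt one_lt_two)
  have h2 := (h1.mul (tendsto_two_pow_mul_transitionMatrix_sub Q T i j)).add_const
    ((1 : Matrix _ _ ℝ) i j)
  rw [zero_mul, zero_add] at h2
  refine h2.congr fun k => ?_
  rw [← mul_assoc, inv_mul_cancel₀ (by positivity), one_mul, sub_add_cancel]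

/-- `exp (t Q)` is the limit of `(1 + t Q / 2^k) ^ 2^k`, and `1 + t Q / 2^k` has nonnegative entries
once `k` is large. -/
theorem transitionMatrix_nonneg {Q : Matrix (Fin h) (Fin h) ℝ} (hQ : IsGenerator Q) {t : ℝ}
    (ht : 0 ≤ t) (i j : Fin h) : 0 ≤ transitionMatrix Q t i j := by
  have : Nonempty (Fin h) := ⟨i⟩
  have key := Matrix.tendsto_pow_two_pow_exp (fun k => 1 + (t / 2 ^ k) • Q) (t • Q) (by
    refine tendsto_const_nhds.congr fun k => ?_
    rw [add_sub_cancel_left, smul_smul, mul_div_cancel₀ _ (by positivity)])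
  have key' := tendsto_pi_nhds.1 (tendsto_pi_nhds.1 key i) j
  refine ge_of_tendsto key' ?_
  have hev : ∀ᶠ k : ℕ in atTop, ∀ i, 0 ≤ 1 + t / 2 ^ k * Q i i := by
    refine eventually_all.2 fun i => ?_
    have h1 : Tendsto (fun k : ℕ => ((2 ^ k : ℝ))⁻¹) atTop (𝓝 0) :=
      tendsto_inv_atTop_zero.comp (tendsto_pow_atTop_atTop_of_one_lt one_lt_two)
    have h2 : Tendsto (fun k : ℕ => 1 + t / 2 ^ k * Q i i) atTop (𝓝 1) := by
      have := ((h1.const_mul t).mul_const (Q i i)).const_add 1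
      simpa [div_eq_mul_inv] using this
    exact (h2.eventually (lt_mem_nhds zero_lt_one)).mono fun _ => le_of_lt
  filter_upwards [hev] with k hk
  refine Matrix.pow_apply_nonneg (fun a b => ?_) _ i j
  rw [Matrix.add_apply, Matrix.smul_apply, Matrix.one_apply]
  split_ifs with hab
  · subst hab; exact hk a
  · rw [zero_add]
    exact mul_nonneg (by positivity) (hQ.off_diag_nonneg a b hab)

/-- The upper right block of the `2 ^ k`-th power of `[P, w ∘ P; 0, P]`, where `P` is the transition
matrix over the time `d / 2 ^ k` and `w ∘ P` is an entrywise product. -/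
noncomputable def weightedTransition (w : ℝ → Fin h → Fin h → ℝ) :
    ℕ → ℝ → Matrix (Fin h) (Fin h) ℝ
  | 0, d => Matrix.of fun i j => w d i j * transitionMatrix Q d i j
  | k + 1, d => weightedTransition w k (d / 2) * transitionMatrix Q (d / 2) +
      transitionMatrix Q (d / 2) * weightedTransition w k (d / 2)

/-- Squaring `[P, W; 0, P]` gives the corner `P W + W P`, which is the recursion of
`weightedTransition`: halving the mesh corresponds to one more squaring. -/
theorem fromBlocks_weightedTransition (w : ℝ → Fin h → Fin h → ℝ) (k : ℕ) (d : ℝ) :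
    Matrix.fromBlocks (transitionMatrix Q d) (weightedTransition Q w k d) 0
      (transitionMatrix Q d) =
    Matrix.fromBlocks (transitionMatrix Q (d / 2 ^ k)) (weightedTransition Q w 0 (d / 2 ^ k)) 0
      (transitionMatrix Q (d / 2 ^ k)) ^ 2 ^ k := by
  induction k generalizing d with
  | zero => simp
  | succ k ih =>
    have e : d / 2 ^ (k + 1) = d / 2 / 2 ^ k := by rw [pow_succ']; field_simp
    rw [e, pow_succ, pow_mul, ← ih, sq, Matrix.fromBlocks_multiply]
    simp only [Matrix.mul_zero, Matrix.zero_mul, add_zero, zero_add, ← transitionMatrix_add,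
      add_halves, weightedTransition]
    rw [add_comm (transitionMatrix Q (d / 2) * _)]

/-- The hypothesis `hV` is the first-order expansion of the corner block; the diagonal blocks
contribute the derivative `Q` of the semigroup. -/
theorem tendsto_weightedTransition (w : ℝ → Fin h → Fin h → ℝ) (V : Matrix (Fin h) (Fin h) ℝ)
    (T : ℝ) (hV : ∀ i j, Tendsto (fun k : ℕ =>
      2 ^ k * (w (T / 2 ^ k) i j * transitionMatrix Q (T / 2 ^ k) i j)) atTop (𝓝 (T * V i j)))
    (x y : Fin h) :
    Tendsto (fun k => weightedTransition Q w k T x y) atTop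
      (𝓝 (NormedSpace.exp (T • Matrix.fromBlocks Q V 0 Q) (Sum.inl x) (Sum.inr y))) := by
  have : Nonempty (Fin h) := ⟨x⟩
  have key := Matrix.tendsto_pow_two_pow_exp (fun k => Matrix.fromBlocks
    (transitionMatrix Q (T / 2 ^ k)) (weightedTransition Q w 0 (T / 2 ^ k)) 0
      (transitionMatrix Q (T / 2 ^ k))) (T • Matrix.fromBlocks Q V 0 Q) (by
    rw [← Matrix.fromBlocks_one]
    refine tendsto_pi_nhds.2 fun i => tendsto_pi_nhds.2 fun j => ?_
    rcases i with i | i <;> rcases j with j | j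
    · simpa [-Matrix.fromBlocks_one] using tendsto_two_pow_mul_transitionMatrix_sub Q T i j
    · simpa [weightedTransition] using hV i j
    · simp
    · simpa [-Matrix.fromBlocks_one] using tendsto_two_pow_mul_transitionMatrix_sub Q T i j)
  simp_rw [← fromBlocks_weightedTransition] at key
  exact tendsto_pi_nhds.1 (tendsto_pi_nhds.1 key (Sum.inl x)) (Sum.inr y)

end TransitionMatrix

/-! ### Additivity of jump counts and holding times over adjacent intervals. -/

section Additivity

variable {Ω : Type*} {h : ℕ} (X : ℝ≥0 → Ω → Fin h)

theorem jumpCount_self (i j : Fin h) (a : ℝ≥0) (ω : Ω) : jumpCount X i j a a ω = 0 := by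
  simp [jumpCount]

theorem jumpCount_add (i j : Fin h) {a b c : ℝ≥0} (hab : a ≤ b) (hbc : b ≤ c) (ω : Ω) :
    jumpCount X i j a c ω = jumpCount X i j a b ω + jumpCount X i j b c ω := by
  rw [jumpCount, jumpCount, jumpCount, ← ENat.toENNReal_add, ← Set.encard_union_eq]
  · congr 2
    ext u
    simp only [← Set.Ioc_union_Ioc_eq_Ioc hab hbc, Set.mem_union, Set.mem_ofPred_eq]
    tauto
  · exact Set.disjoint_left.2 fun u hu hu' => not_le.2 hu'.1.1 hu.1.2

theorem holdingTime_self (i : Fin h) (a : ℝ≥0) (ω : Ω) : holdingTime X i a a ω = 0 :=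
  measure_mono_null (t := {(a : ℝ)}) (fun u hu => by simpa using hu.1) (by simp)

theorem holdingTime_add (i : Fin h) {a b c : ℝ≥0} (hab : a ≤ b) (hbc : b ≤ c) (ω : Ω) :
    holdingTime X i a c ω = holdingTime X i a b ω + holdingTime X i b c ω := by
  have hab' : (a : ℝ) ≤ b := hab
  have hbc' : (b : ℝ) ≤ c := hbc
  rw [holdingTime, ← measure_inter_add_sdiff _ (measurableSet_Iic (a := (b : ℝ)))]
  congr 1
  · refine congrArg _ (Set.ext fun u => ?_)
    simp only [Set.mem_inter_iff, Set.mem_ofPred_eq, Set.mem_Icc, Set.mem_Iic]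
    exact ⟨fun H => ⟨⟨H.1.1.1, H.2⟩, H.1.2⟩, fun H => ⟨⟨⟨H.1.1, H.1.2.trans hbc'⟩, H.2⟩, H.1.2⟩⟩
  -- What remains is the part over `(b, c]`, which differs from that over `[b, c]` by a null set.
  · refine measure_congr ?_
    filter_upwards [Measure.ae_ne volume (b : ℝ)] with u hu
    refine propext ?_
    change ((u ∈ Set.Icc (a : ℝ) c ∧ X u.toNNReal ω = i) ∧ ¬ u ≤ b) ↔
      (u ∈ Set.Icc (b : ℝ) c ∧ X u.toNNReal ω = i)
    simp only [Set.mem_Icc, not_le]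
    exact ⟨fun H => ⟨⟨H.2.le, H.1.1.2⟩, H.1.2⟩,
      fun H => ⟨⟨⟨hab'.trans H.1.1, H.1.2⟩, H.2⟩, lt_of_le_of_ne H.1.1 hu.symm⟩⟩

theorem sum_eq_of_additive {F : ℝ≥0 → ℝ≥0 → ℝ≥0∞} (h0 : ∀ a, F a a = 0)
    (hadd : ∀ a b c, a ≤ b → b ≤ c → F a c = F a b + F b c) {m : ℕ} {t : Fin (m + 1) → ℝ≥0}
    (ht : Monotone t) : F (t 0) (t (Fin.last m)) = ∑ s : Fin m, F (t s.castSucc) (t s.succ) := by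
  induction m with
  | zero => simpa using h0 (t 0)
  | succ m ih =>
    rw [Fin.sum_univ_castSucc, hadd _ (t (Fin.last m).castSucc) _ (ht (Fin.zero_le _))
      (ht (Fin.le_last _))]
    have := ih (t := fun s => t s.castSucc) (ht.comp Fin.strictMono_castSucc.monotone)
    rw [Fin.castSucc_zero] at this
    rw [this]
    rfl

end Additivity

/-! ### Dyadic subdivisions and switches of a right-continuous path. -/

section Path

/-- Sum of `w (q - p) (f p) (f q)` over the `2 ^ k` consecutive dyadic subintervals `[p, q]` of
`[a, b]`. -/
noncomputable def dyadicSum {S M : Type*} [Add M] (w : ℝ → S → S → M) (f : ℝ≥0 → S) :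
    ℕ → ℝ≥0 → ℝ≥0 → M
  | 0, a, b => w ((b : ℝ) - a) (f a) (f b)
  | k + 1, a, b => dyadicSum w f k a ((a + b) / 2) + dyadicSum w f k ((a + b) / 2) b

/-- The number of dyadic subintervals at level `k` on which the endpoint values of `f` differ. -/
noncomputable def switchCount {S : Type*} [DecidableEq S] (f : ℝ≥0 → S) : ℕ → ℝ≥0 → ℝ≥0 → ℕ :=
  dyadicSum (fun _ x z => if x = z then 0 else 1) f

theorem NNReal.coe_midpoint_sub_left (a b : ℝ≥0) : (((a + b) / 2 : ℝ≥0) : ℝ) - a = (b - a) / 2 := by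
  push_cast; ring

theorem NNReal.coe_right_sub_midpoint (a b : ℝ≥0) :
    (b : ℝ) - ((a + b) / 2 : ℝ≥0) = (b - a) / 2 := by
  push_cast; ring

theorem NNReal.lt_midpoint {a b : ℝ≥0} (hab : a < b) : a < (a + b) / 2 := by
  have : (a : ℝ) < b := hab
  rw [← NNReal.coe_lt_coe]; push_cast; linarith

theorem NNReal.midpoint_lt {a b : ℝ≥0} (hab : a < b) : (a + b) / 2 < b := by
  have : (a : ℝ) < b := hab
  rw [← NNReal.coe_lt_coe]; push_cast; linarith

theorem NNReal.le_midpoint {a b : ℝ≥0} (hab : a ≤ b) : a ≤ (a + b) / 2 := by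
  have : (a : ℝ) ≤ b := hab
  rw [← NNReal.coe_le_coe]; push_cast; linarith

theorem NNReal.midpoint_le {a b : ℝ≥0} (hab : a ≤ b) : (a + b) / 2 ≤ b := by
  have : (a : ℝ) ≤ b := hab
  rw [← NNReal.coe_le_coe]; push_cast; linarith

section Switch

variable {S : Type*} [DecidableEq S] (f : ℝ≥0 → S)

theorem switchCount_zero (a b : ℝ≥0) : switchCount f 0 a b = if f a = f b then 0 else 1 := rfl

theorem switchCount_succ (k : ℕ) (a b : ℝ≥0) : switchCount f (k + 1) a b =
    switchCount f k a ((a + b) / 2) + switchCount f k ((a + b) / 2) b := rfl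

/-- If the endpoint values differ, the midpoint value differs from at least one of them. -/
theorem switchCount_le_succ (k : ℕ) (a b : ℝ≥0) :
    switchCount f k a b ≤ switchCount f (k + 1) a b := by
  induction k generalizing a b with
  | zero =>
    simp only [switchCount_succ, switchCount_zero]
    split_ifs <;> simp_all
  | succ k ih =>
    rw [switchCount_succ, switchCount_succ f (k + 1)]
    exact add_le_add (ih _ _) (ih _ _)

theorem monotone_switchCount (a b : ℝ≥0) : Monotone fun k => switchCount f k a b :=
  monotone_nat_of_le_succ fun k => switchCount_le_succ f k a b

variable {f}

/-- Two monotone sequences whose sum is constant are both constant. -/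
theorem switchCount_stable_halves {k : ℕ} {a b : ℝ≥0}
    (hk : ∀ m, k + 1 ≤ m → switchCount f m a b = switchCount f (k + 1) a b) :
    (∀ m, k ≤ m → switchCount f m a ((a + b) / 2) = switchCount f k a ((a + b) / 2)) ∧
      ∀ m, k ≤ m → switchCount f m ((a + b) / 2) b = switchCount f k ((a + b) / 2) b := by
  refine ⟨fun m hm => ?_, fun m hm => ?_⟩ <;>
  · have h1 := hk (m + 1) (by omega)
    rw [switchCount_succ, switchCount_succ] at h1
    have h2 := monotone_switchCount f a ((a + b) / 2) hm
    have h3 := monotone_switchCount f ((a + b) / 2) b hm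
    simp only at h2 h3
    omega

/-- The witness `v` is the right endpoint of the level-`m` piece containing `u`. Such points come
arbitrarily close to `u` from the right, where right-continuity can use them. -/
theorem exists_dyadic_eq_of_switchCount_eq_zero (m : ℕ) {a b : ℝ≥0} (hab : a < b)
    (hs : ∀ k, switchCount f k a b = 0) {u : ℝ≥0} (hu : u ∈ Set.Ico a b) :
    ∃ v, u < v ∧ (v : ℝ) ≤ u + (b - a) / 2 ^ m ∧ f v = f a := by
  induction m generalizing a b with
  | zero =>
    refine ⟨b, hu.2, ?_, ?_⟩
    · have : (a : ℝ) ≤ u := hu.1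
      simp only [pow_zero, div_one]; linarith
    · have := hs 0
      rw [switchCount_zero] at this
      by_contra hne
      rw [if_neg (Ne.symm hne)] at this
      exact one_ne_zero this
  | succ m ih =>
    have hl : ∀ k, switchCount f k a ((a + b) / 2) = 0 := fun k => by
      have := hs (k + 1); rw [switchCount_succ] at this; omega
    have hr : ∀ k, switchCount f k ((a + b) / 2) b = 0 := fun k => by
      have := hs (k + 1); rw [switchCount_succ] at this; omega
    rcases lt_or_ge u ((a + b) / 2) with hlt | hge
    · obtain ⟨v, h1, h2, h3⟩ := ih (NNReal.lt_midpoint hab) hl ⟨hu.1, hlt⟩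
      refine ⟨v, h1, ?_, h3⟩
      rwa [NNReal.coe_midpoint_sub_left, div_div, ← pow_succ'] at h2
    · obtain ⟨v, h1, h2, h3⟩ := ih (NNReal.midpoint_lt hab) hr ⟨hge, hu.2⟩
      refine ⟨v, h1, ?_, ?_⟩
      · rwa [NNReal.coe_right_sub_midpoint, div_div, ← pow_succ'] at h2
      · have := hl 0
        rw [switchCount_zero] at this
        by_contra hne
        rw [if_neg (fun e => hne (h3.trans e.symm))] at this
        exact one_ne_zero this

theorem exists_div_two_pow_lt (c : ℝ) {ε : ℝ} (hε : 0 < ε) : ∃ m : ℕ, c / 2 ^ m < ε := by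
  obtain ⟨m, hm⟩ := pow_unbounded_of_one_lt (c / ε) (one_lt_two (α := ℝ))
  refine ⟨m, ?_⟩
  rw [div_lt_iff₀ (by positivity)]
  rw [div_lt_iff₀ hε] at hm
  linarith

variable (hf : ∀ u, ∃ c > u, ∀ v ∈ Set.Ico u c, f v = f u)
include hf

theorem eq_left_of_switchCount_eq_zero {a b : ℝ≥0} (hab : a < b)
    (hs : ∀ k, switchCount f k a b = 0) {u : ℝ≥0} (hu : u ∈ Set.Icc a b) : f u = f a := by
  rcases eq_or_lt_of_le hu.2 with rfl | hlt
  · have := hs 0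
    rw [switchCount_zero] at this
    by_contra hne
    rw [if_neg (Ne.symm hne)] at this
    exact one_ne_zero this
  · obtain ⟨c, hc, hcf⟩ := hf u
    obtain ⟨m, hm⟩ := exists_div_two_pow_lt ((b : ℝ) - a) (sub_pos.2 (NNReal.coe_lt_coe.2 hc))
    obtain ⟨v, h1, h2, h3⟩ := exists_dyadic_eq_of_switchCount_eq_zero m hab hs ⟨hu.1, hlt⟩
    rw [← h3, hcf v ⟨h1.le, ?_⟩]
    rw [← NNReal.coe_lt_coe]; linarith

/-- Bisection: at every level exactly one half carries the switch, and the path is constant on the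
other half. -/
theorem exists_bracket_of_switchCount_eq_one (m : ℕ) {a b : ℝ≥0} (hab : a < b) (hne : f a ≠ f b)
    (hs : ∀ k, switchCount f k a b = 1) :
    ∃ p q : ℝ≥0, a ≤ p ∧ p < q ∧ q ≤ b ∧ (q : ℝ) - p ≤ (b - a) / 2 ^ m ∧
      (∀ u ∈ Set.Icc a p, f u = f a) ∧ ∀ u ∈ Set.Icc q b, f u = f b := by
  induction m generalizing a b with
  | zero =>
    refine ⟨a, b, le_rfl, hab, le_rfl, by simp, fun u hu => ?_, fun u hu => ?_⟩
    · rw [le_antisymm hu.2 hu.1]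
    · rw [le_antisymm hu.2 hu.1]
  | succ m ih =>
    have hlt₁ := NNReal.lt_midpoint hab
    have hlt₂ := NNReal.midpoint_lt hab
    have hsum : ∀ k, switchCount f k a ((a + b) / 2) + switchCount f k ((a + b) / 2) b = 1 :=
      fun k => hs (k + 1)
    have hml : ∀ k, switchCount f 0 a ((a + b) / 2) ≤ switchCount f k a ((a + b) / 2) :=
      fun k => monotone_switchCount f _ _ (Nat.zero_le k)
    have hmr : ∀ k, switchCount f 0 ((a + b) / 2) b ≤ switchCount f k ((a + b) / 2) b :=
      fun k => monotone_switchCount f _ _ (Nat.zero_le k)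
    have hs0 := hsum 0
    by_cases hmid : f a = f ((a + b) / 2)
    · have h0 : switchCount f 0 a ((a + b) / 2) = 0 := by rw [switchCount_zero, if_pos hmid]
      have hl : ∀ k, switchCount f k a ((a + b) / 2) = 0 := fun k => by
        have := hsum k; have := hmr k; omega
      have hr : ∀ k, switchCount f k ((a + b) / 2) b = 1 := fun k => by
        have := hsum k; have := hl k; omega
      obtain ⟨p, q, h1, h2, h3, h4, h5, h6⟩ := ih hlt₂ (hmid ▸ hne) hr
      refine ⟨p, q, hlt₁.le.trans h1, h2, h3, ?_, fun u hu => ?_, h6⟩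
      · rwa [NNReal.coe_right_sub_midpoint, div_div, ← pow_succ'] at h4
      · rcases le_total u ((a + b) / 2) with hu' | hu'
        · exact eq_left_of_switchCount_eq_zero hf hlt₁ hl ⟨hu.1, hu'⟩
        · rw [h5 u ⟨hu', hu.2⟩, hmid]
    · have h0 : switchCount f 0 a ((a + b) / 2) = 1 := by rw [switchCount_zero, if_neg hmid]
      have hr : ∀ k, switchCount f k ((a + b) / 2) b = 0 := fun k => by
        have := hsum k; have := hml k; omega
      have hl : ∀ k, switchCount f k a ((a + b) / 2) = 1 := fun k => by
        have := hsum k; have := hr k; omega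
      have hmb : f b = f ((a + b) / 2) :=
        eq_left_of_switchCount_eq_zero hf hlt₂ hr ⟨hlt₂.le, le_rfl⟩
      obtain ⟨p, q, h1, h2, h3, h4, h5, h6⟩ := ih hlt₁ hmid hl
      refine ⟨p, q, h1, h2, h3.trans hlt₂.le, ?_, h5, fun u hu => ?_⟩
      · rwa [NNReal.coe_midpoint_sub_left, div_div, ← pow_succ'] at h4
      · rcases le_total u ((a + b) / 2) with hu' | hu'
        · rw [h6 u ⟨hu.1, hu'⟩, hmb]
        · rw [eq_left_of_switchCount_eq_zero hf hlt₂ hr ⟨hu', hu.2⟩, hmb]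

/-- The switch time is the infimum of the times from which the path keeps the value `f b` up to `b`.
Left limits are not assumed; here the left limit at the switch comes from the brackets. -/
theorem exists_switch_of_switchCount_eq_one {a b : ℝ≥0} (hab : a < b) (hne : f a ≠ f b)
    (hs : ∀ k, switchCount f k a b = 1) :
    ∃ τ, a < τ ∧ τ ≤ b ∧ (∀ u ∈ Set.Ico a τ, f u = f a) ∧ ∀ u ∈ Set.Icc τ b, f u = f b := by
  set R : Set ℝ≥0 := {q | a ≤ q ∧ q ≤ b ∧ ∀ u ∈ Set.Icc q b, f u = f b} with hR
  have hbR : b ∈ R := ⟨hab.le, le_rfl, fun u hu => by rw [le_antisymm hu.2 hu.1]⟩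
  have hbdd : BddBelow R := ⟨0, fun _ _ => zero_le⟩
  have hτb : sInf R ≤ b := csInf_le hbdd hbR
  have haτ : a ≤ sInf R := le_csInf ⟨b, hbR⟩ fun q hq => hq.1
  -- A bracket `[p, q]` shorter than `sInf R - u` has `q ≥ sInf R`, hence `p ≥ u`.
  have hbracket : ∀ u, a ≤ u → u < sInf R → f u = f a := by
    intro u hau hu
    obtain ⟨m, hm⟩ := exists_div_two_pow_lt ((b : ℝ) - a) (sub_pos.2 (NNReal.coe_lt_coe.2 hu))
    obtain ⟨p, q, h1, h2, h3, h4, h5, h6⟩ := exists_bracket_of_switchCount_eq_one hf m hab hne hs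
    have hq : sInf R ≤ q := csInf_le hbdd ⟨h1.trans h2.le, h3, h6⟩
    have hq' : ((sInf R : ℝ≥0) : ℝ) ≤ q := hq
    refine h5 u ⟨hau, ?_⟩
    rw [← NNReal.coe_le_coe]; linarith
  have hright : ∀ u, sInf R < u → u ≤ b → f u = f b := by
    intro u hu hub
    obtain ⟨q, hq, hqu⟩ := exists_lt_of_csInf_lt ⟨b, hbR⟩ hu
    exact hq.2.2 u ⟨hqu.le, hub⟩
  have hτ : f (sInf R) = f b := by
    rcases eq_or_lt_of_le hτb with he | hlt
    · rw [he]
    · obtain ⟨c, hc, hcf⟩ := hf (sInf R)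
      obtain ⟨v, hv1, hv2⟩ := exists_between (lt_min hc hlt)
      rw [← hcf v ⟨hv1.le, hv2.trans_le (min_le_left _ _)⟩]
      exact hright v hv1 (hv2.le.trans (min_le_right _ _))
  refine ⟨sInf R, lt_of_le_of_ne haτ fun he => hne (by rw [he, hτ]), hτb,
    fun u hu => hbracket u hu.1 hu.2, fun u hu => ?_⟩
  rcases eq_or_lt_of_le hu.1 with he | hlt
  · rw [← he, hτ]
  · exact hright u hlt hu.2

end Switch

/-! ### Jump counts and holding times as limits of dyadic sums. -/

variable {Ω : Type*} {h : ℕ} {X : ℝ≥0 → Ω → Fin h} {ω : Ω}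

theorem eq_of_eventually_left_eq {S : Type*} {f : ℝ≥0 → S} {p u : ℝ≥0} {x i : S} (hpu : p < u)
    (hx : ∀ v ∈ Set.Ico p u, f v = x) (hi : ∀ᶠ v in 𝓝[<] u, f v = i) : x = i := by
  obtain ⟨l, hl, hl'⟩ := (mem_nhdsLT_iff_exists_Ioo_subset' hpu).1 hi
  obtain ⟨v, hv1, hv2⟩ := exists_between (max_lt hpu hl)
  rw [← hx v ⟨(le_max_left _ _).trans hv1.le, hv2⟩]
  exact hl' ⟨(le_max_right _ _).trans_lt hv1, hv2⟩

theorem jumpCount_eq_zero_of_const {i j : Fin h} (hij : i ≠ j) {a b : ℝ≥0}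
    (hc : ∀ u ∈ Set.Icc a b, X u ω = X a ω) : jumpCount X i j a b ω = 0 := by
  rw [jumpCount, Set.encard_eq_zero.2 (Set.eq_empty_of_forall_notMem ?_), ENat.toENNReal_zero]
  rintro u ⟨hu, hl, hr⟩
  refine hij ?_
  rw [← eq_of_eventually_left_eq (f := fun v => X v ω) hu.1
    (fun v hv => hc v ⟨hv.1, hv.2.le.trans hu.2⟩) hl, ← hr, hc u ⟨hu.1.le, hu.2⟩]

theorem jumpCount_of_single_switch {i j : Fin h} (hij : i ≠ j) {a τ b : ℝ≥0} (haτ : a < τ)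
    (hτb : τ ≤ b) (hl : ∀ u ∈ Set.Ico a τ, X u ω = X a ω) (hr : ∀ u ∈ Set.Icc τ b, X u ω = X b ω) :
    jumpCount X i j a b ω = if X a ω = i ∧ X b ω = j then 1 else 0 := by
  have hτ := hr τ ⟨le_rfl, hτb⟩
  rw [jumpCount_add X i j haτ.le hτb, jumpCount_eq_zero_of_const hij (a := τ)
    (fun u hu => by rw [hr u hu, hτ]), add_zero, jumpCount]
  have hset : {u : ℝ≥0 | u ∈ Set.Ioc a τ ∧ (∀ᶠ v in 𝓝[<] u, X v ω = i) ∧ X u ω = j} =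
      {u | u = τ ∧ X a ω = i ∧ X b ω = j} := by
    ext u
    constructor
    · rintro ⟨hu, hi, hj⟩
      have hai : X a ω = i := eq_of_eventually_left_eq (f := fun v => X v ω) hu.1
        (fun v hv => hl v ⟨hv.1, hv.2.trans_le hu.2⟩) hi
      rcases eq_or_lt_of_le hu.2 with rfl | hlt
      · exact ⟨rfl, hai, by rw [← hτ, hj]⟩
      · exact absurd (by rw [← hai, ← hl u ⟨hu.1.le, hlt⟩, hj]) hij
    · rintro ⟨rfl, hi, hj⟩
      refine ⟨⟨haτ, le_rfl⟩, ?_, hτ.trans hj⟩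
      filter_upwards [Ico_mem_nhdsLT haτ] with v hv
      rw [hl v hv, hi]
  rw [hset]
  split_ifs with hc
  · simp [hc]
  · simp [hc]

/-- The weight whose dyadic sums count the changes from `i` to `j`. -/
def jumpWeight (i j : Fin h) : ℝ → Fin h → Fin h → ℝ := fun _ x z => if x = i ∧ z = j then 1 else 0

/-- The weight whose dyadic sums approximate the time spent in `i`. -/
def holdingWeight (i : Fin h) : ℝ → Fin h → Fin h → ℝ := fun d x _ => if x = i then d else 0

/-- Dyadic sums along the path `X · ω`, with values in `ℝ≥0∞`. -/
noncomputable def dyadicFunctional (w : ℝ → Fin h → Fin h → ℝ) (X : ℝ≥0 → Ω → Fin h) (k : ℕ)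
    (a b : ℝ≥0) (ω : Ω) : ℝ≥0∞ :=
  dyadicSum (fun d x z => ENNReal.ofReal (w d x z)) (fun u => X u ω) k a b

theorem dyadicFunctional_zero (w : ℝ → Fin h → Fin h → ℝ) (X : ℝ≥0 → Ω → Fin h) (a b : ℝ≥0)
    (ω : Ω) : dyadicFunctional w X 0 a b ω = ENNReal.ofReal (w ((b : ℝ) - a) (X a ω) (X b ω)) := rfl

theorem dyadicFunctional_succ (w : ℝ → Fin h → Fin h → ℝ) (X : ℝ≥0 → Ω → Fin h) (k : ℕ)
    (a b : ℝ≥0) (ω : Ω) : dyadicFunctional w X (k + 1) a b ω =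
      dyadicFunctional w X k a ((a + b) / 2) ω + dyadicFunctional w X k ((a + b) / 2) b ω := rfl

theorem dyadicFunctional_jumpWeight_le {i j : Fin h} (hij : i ≠ j) (k : ℕ) (a b : ℝ≥0) :
    dyadicFunctional (jumpWeight i j) X k a b ω ≤ switchCount (fun u => X u ω) k a b := by
  induction k generalizing a b with
  | zero =>
    rw [dyadicFunctional_zero, switchCount_zero, jumpWeight]
    split_ifs with h1 h2
    · exact absurd (h1.1.symm.trans (h2.trans h1.2)) hij
    all_goals simp
  | succ k ih =>
    rw [dyadicFunctional_succ, switchCount_succ, Nat.cast_add]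
    exact add_le_add (ih _ _) (ih _ _)

theorem dyadicFunctional_holdingWeight_le (i : Fin h) (k : ℕ) {a b : ℝ≥0} (hab : a ≤ b) :
    dyadicFunctional (holdingWeight i) X k a b ω ≤ ENNReal.ofReal (b - a) := by
  induction k generalizing a b with
  | zero =>
    rw [dyadicFunctional_zero, holdingWeight]
    split_ifs <;> simp
  | succ k ih =>
    rw [dyadicFunctional_succ]
    refine (add_le_add (ih (NNReal.le_midpoint hab)) (ih (NNReal.midpoint_le hab))).trans ?_
    have : (0 : ℝ) ≤ b - a := sub_nonneg.2 (NNReal.coe_le_coe.2 hab)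
    rw [NNReal.coe_midpoint_sub_left, NNReal.coe_right_sub_midpoint,
      ← ENNReal.ofReal_add (by positivity) (by positivity), add_halves]

variable (hf : ∀ u, ∃ c > u, ∀ v ∈ Set.Ico u c, X v ω = X u ω)
include hf

/-- Stability passes to the halves, so it reaches every level-`k` piece. There the count is `0` or
`1` at all finer levels: the path is constant or switches exactly once, and in both cases the
endpoints determine the jumps. -/
theorem dyadicFunctional_jumpWeight_eq {i j : Fin h} (hij : i ≠ j) (k : ℕ) {a b : ℝ≥0}
    (hab : a < b) (hk : ∀ m, k ≤ m → switchCount (fun u => X u ω) m a b =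
      switchCount (fun u => X u ω) k a b) :
    dyadicFunctional (jumpWeight i j) X k a b ω = jumpCount X i j a b ω := by
  induction k generalizing a b with
  | zero =>
    simp only [switchCount_zero] at hk
    rw [dyadicFunctional_zero, jumpWeight]
    by_cases hc : X a ω = X b ω
    · rw [if_neg (fun H => hij (H.1.symm.trans (hc.trans H.2))), ENNReal.ofReal_zero]
      have hs : ∀ m, switchCount (fun u => X u ω) m a b = 0 := fun m => by
        rw [hk m (Nat.zero_le m), if_pos hc]
      exact (jumpCount_eq_zero_of_const hij fun u hu => eq_left_of_switchCount_eq_zero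
        (f := fun u => X u ω) hf hab hs (u := u) hu).symm
    · obtain ⟨τ, h1, h2, h3, h4⟩ := exists_switch_of_switchCount_eq_one (f := fun u => X u ω) hf hab
        hc (fun m => by rw [hk m (Nat.zero_le m), if_neg hc])
      rw [jumpCount_of_single_switch hij h1 h2 h3 h4]
      split_ifs <;> simp
  | succ k ih =>
    obtain ⟨hl, hr⟩ := switchCount_stable_halves hk
    rw [dyadicFunctional_succ, ih (NNReal.lt_midpoint hab) hl, ih (NNReal.midpoint_lt hab) hr,
      ← jumpCount_add X i j (NNReal.lt_midpoint hab).le (NNReal.midpoint_lt hab).le]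

/-- The sum is exact on pieces where the path is constant. On a piece with a switch both quantities
lie between `0` and the mesh, so the total error is at most the mesh times the number of switches.
-/
theorem dyadicFunctional_holdingWeight_close (i : Fin h) (k : ℕ) {a b : ℝ≥0}
    (hab : a < b) (hk : ∀ m, k ≤ m → switchCount (fun u => X u ω) m a b =
      switchCount (fun u => X u ω) k a b) :
    dyadicFunctional (holdingWeight i) X k a b ω ≤ holdingTime X i a b ω +
        ENNReal.ofReal ((b - a) / 2 ^ k) * switchCount (fun u => X u ω) k a b ∧
      holdingTime X i a b ω ≤ dyadicFunctional (holdingWeight i) X k a b ω +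
        ENNReal.ofReal ((b - a) / 2 ^ k) * switchCount (fun u => X u ω) k a b := by
  induction k generalizing a b with
  | zero =>
    simp only [switchCount_zero] at hk ⊢
    by_cases hc : X a ω = X b ω
    · have hconst : ∀ u ∈ Set.Icc (a : ℝ) b, X u.toNNReal ω = X a ω := fun u hu =>
        eq_left_of_switchCount_eq_zero (f := fun u => X u ω) hf hab
          (fun m => by rw [hk m (Nat.zero_le m), if_pos hc])
          ⟨NNReal.le_toNNReal_of_coe_le hu.1, Real.toNNReal_le_iff_le_coe.2 hu.2⟩
      have heq : dyadicFunctional (holdingWeight i) X 0 a b ω = holdingTime X i a b ω := by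
        rw [dyadicFunctional_zero, holdingWeight, holdingTime]
        split_ifs with hi
        · rw [← Real.volume_Icc]
          congr 1
          ext u
          exact ⟨fun hu => ⟨hu, (hconst u hu).trans hi⟩, fun hu => hu.1⟩
        · rw [ENNReal.ofReal_zero, eq_comm, ← measure_empty (μ := (volume : Measure ℝ))]
          congr 1
          refine Set.eq_empty_of_forall_notMem fun u hu => hi ?_
          rw [← hconst u hu.1, hu.2]
      rw [heq]
      exact ⟨le_self_add, le_self_add⟩
    · rw [if_neg hc, pow_zero, div_one, Nat.cast_one, mul_one]
      refine ⟨(dyadicFunctional_holdingWeight_le i 0 hab.le).trans le_add_self,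
        le_trans ?_ le_add_self⟩
      rw [← Real.volume_Icc]
      exact measure_mono fun u hu => hu.1
  | succ k ih =>
    obtain ⟨hl, hr⟩ := switchCount_stable_halves hk
    have h1 := ih (NNReal.lt_midpoint hab) hl
    have h2 := ih (NNReal.midpoint_lt hab) hr
    rw [NNReal.coe_midpoint_sub_left, div_div, ← pow_succ'] at h1
    rw [NNReal.coe_right_sub_midpoint, div_div, ← pow_succ'] at h2
    rw [dyadicFunctional_succ, switchCount_succ, Nat.cast_add, mul_add,
      holdingTime_add X i (NNReal.lt_midpoint hab).le (NNReal.midpoint_lt hab).le]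
    exact ⟨(add_le_add h1.1 h2.1).trans (le_of_eq (add_add_add_comm _ _ _ _)),
      (add_le_add h1.2 h2.2).trans (le_of_eq (add_add_add_comm _ _ _ _))⟩

omit hf in
theorem exists_switchCount_stable {S : Type*} [DecidableEq S] {f : ℝ≥0 → S} {a b : ℝ≥0} {N : ℕ}
    (hN : ∀ k, switchCount f k a b ≤ N) :
    ∃ K, ∀ m, K ≤ m → switchCount f m a b = switchCount f K a b := by
  obtain ⟨_, ⟨K, rfl⟩, hK⟩ := Set.exists_max_image (Set.range fun k => switchCount f k a b) id
    ((Set.finite_Iic N).subset (by rintro _ ⟨k, rfl⟩; exact hN k)) ⟨_, 0, rfl⟩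
  exact ⟨K, fun m hm => le_antisymm (hK _ ⟨m, rfl⟩) (monotone_switchCount f a b hm)⟩

theorem tendsto_dyadicFunctional_jumpWeight {i j : Fin h} (hij : i ≠ j) {a b : ℝ≥0} (hab : a < b)
    {N : ℕ} (hN : ∀ k, switchCount (fun u => X u ω) k a b ≤ N) :
    Tendsto (fun k => dyadicFunctional (jumpWeight i j) X k a b ω) atTop
      (𝓝 (jumpCount X i j a b ω)) := by
  obtain ⟨K, hK⟩ := exists_switchCount_stable hN
  refine tendsto_const_nhds.congr' ?_
  filter_upwards [eventually_ge_atTop K] with k hk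
  exact (dyadicFunctional_jumpWeight_eq hf hij k hab
    fun m hm => (hK m (hk.trans hm)).trans (hK k hk).symm).symm

theorem tendsto_dyadicFunctional_holdingWeight (i : Fin h) {a b : ℝ≥0} (hab : a < b)
    {N : ℕ} (hN : ∀ k, switchCount (fun u => X u ω) k a b ≤ N) :
    Tendsto (fun k => dyadicFunctional (holdingWeight i) X k a b ω) atTop
      (𝓝 (holdingTime X i a b ω)) := by
  obtain ⟨K, hK⟩ := exists_switchCount_stable hN
  have hε : Tendsto (fun k : ℕ => ENNReal.ofReal (((b : ℝ) - a) / 2 ^ k) *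
      (switchCount (fun u => X u ω) K a b : ℝ≥0∞)) atTop (𝓝 0) := by
    have h1 : Tendsto (fun k : ℕ => ((b : ℝ) - a) / 2 ^ k) atTop (𝓝 0) :=
      tendsto_const_nhds.div_atTop (tendsto_pow_atTop_atTop_of_one_lt one_lt_two)
    have h2 := ENNReal.Tendsto.mul_const (b := (switchCount (fun u => X u ω) K a b : ℝ≥0∞))
      (ENNReal.tendsto_ofReal h1) (Or.inr (ENNReal.natCast_ne_top _))
    simpa using h2
  have hfin : holdingTime X i a b ω ≠ ∞ := by
    refine ne_top_of_le_ne_top ENNReal.ofReal_ne_top (b := ENNReal.ofReal (b - a)) ?_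
    rw [← Real.volume_Icc]
    exact measure_mono fun u hu => hu.1
  have hlow := ENNReal.Tendsto.sub (tendsto_const_nhds (x := holdingTime X i a b ω)) hε
    (Or.inl hfin)
  have hup := (tendsto_const_nhds (x := holdingTime X i a b ω)).add hε
  rw [tsub_zero] at hlow
  rw [add_zero] at hup
  refine tendsto_of_tendsto_of_tendsto_of_le_of_le' hlow hup ?_ ?_ <;>
  filter_upwards [eventually_ge_atTop K] with k hk <;>
  have hc := dyadicFunctional_holdingWeight_close hf i k hab
    fun m hm => (hK m (hk.trans hm)).trans (hK k hk).symm <;>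
  rw [hK k hk] at hc
  · exact tsub_le_iff_right.2 hc.2
  · exact hc.1

end Path

/-! ### Finite-dimensional distributions between two observations. -/

section Markov

variable {Ω : Type*} [MeasurableSpace Ω] {μ : Measure Ω} {h : ℕ} {Q : Matrix (Fin h) (Fin h) ℝ}
  {X : ℝ≥0 → Ω → Fin h}

/-- The product of the transition probabilities along the states at the times listed, starting from
a given time and state. -/
noncomputable def pathWeight (Q : Matrix (Fin h) (Fin h) ℝ) :
    ℝ≥0 × Fin h → List (ℝ≥0 × Fin h) → ℝ
  | _, [] => 1
  | p, q :: L => transitionMatrix Q ((q.1 : ℝ) - p.1) p.2 q.2 * pathWeight Q q L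

theorem pathWeight_cons (p q : ℝ≥0 × Fin h) (L : List (ℝ≥0 × Fin h)) :
    pathWeight Q p (q :: L) = transitionMatrix Q ((q.1 : ℝ) - p.1) p.2 q.2 * pathWeight Q q L := rfl

theorem pathWeight_append_cons (a p : ℝ≥0 × Fin h) (A L : List (ℝ≥0 × Fin h)) :
    pathWeight Q a (A ++ p :: L) = pathWeight Q a (A ++ [p]) * pathWeight Q p L := by
  induction A generalizing a with
  | nil => simp [pathWeight]
  | cons b A ih => simp only [List.cons_append, pathWeight_cons, ih b, mul_assoc]

theorem prod_transitionMatrix_eq_pathWeight (p : ℝ≥0 × Fin h) (L : List (ℝ≥0 × Fin h)) :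
    ∏ k : Fin L.length, transitionMatrix Q ((((p :: L).get k.succ).1 : ℝ) -
      ((p :: L).get k.castSucc).1) ((p :: L).get k.castSucc).2 ((p :: L).get k.succ).2 =
    pathWeight Q p L := by
  induction L generalizing p with
  | nil => simp [pathWeight]
  | cons q L ih =>
    rw [pathWeight_cons, ← ih q]
    exact Fin.prod_univ_succ (n := L.length) _

theorem IsCTMC.measureReal_list_of_lt (hX : IsCTMC μ Q X) (p : ℝ≥0 × Fin h)
    (L : List (ℝ≥0 × Fin h)) (hL : (p :: L).Pairwise fun a b => a.1 < b.1) :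
    μ.real {ω | ∀ q ∈ p :: L, X q.1 ω = q.2} =
      μ.real {ω | X p.1 ω = p.2} * pathWeight Q p L := by
  have := hX.markov L.length (fun k => ((p :: L).get k).1)
    (fun a b hab => List.pairwise_iff_get.1 hL a b hab) (fun k => ((p :: L).get k).2)
  rw [← prod_transitionMatrix_eq_pathWeight]
  refine Eq.trans ?_ this
  congr 1
  ext ω
  exact List.forall_mem_iff_get (l := p :: L) (p := fun q => X q.1 ω = q.2)

-- `IsCTMC.markov` needs strictly increasing times, whereas intermediate times may coincide with
-- each other or with observation times. A repeated time with the same state contributes the factor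
-- `1` and is dropped; with different states the event is empty and the factor is `0`.
omit [MeasurableSpace Ω] in
theorem exists_strict_list (Q : Matrix (Fin h) (Fin h) ℝ) (X : ℝ≥0 → Ω → Fin h) (p : ℝ≥0 × Fin h)
    (L : List (ℝ≥0 × Fin h)) (hL : (p :: L).Pairwise fun a b => a.1 ≤ b.1) :
    (∃ L', ((p :: L').Pairwise fun a b => a.1 < b.1) ∧ pathWeight Q p L = pathWeight Q p L' ∧
      ∀ ω, (∀ q ∈ p :: L, X q.1 ω = q.2) ↔ ∀ q ∈ p :: L', X q.1 ω = q.2) ∨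
    (pathWeight Q p L = 0 ∧ ∀ ω, ¬ ∀ q ∈ p :: L, X q.1 ω = q.2) := by
  induction L generalizing p with
  | nil => exact Or.inl ⟨[], by simp, rfl, fun _ => Iff.rfl⟩
  | cons q L ih =>
    have hq := ih q (List.pairwise_cons.1 hL).2
    have hpq : p.1 ≤ q.1 := (List.pairwise_cons.1 hL).1 q List.mem_cons_self
    rcases eq_or_lt_of_le hpq with he | hlt
    · by_cases hs : p.2 = q.2
      · have hpq' : p = q := Prod.ext he hs
        subst hpq'
        simpa [pathWeight_cons] using hq
      · refine Or.inr ⟨by simp [pathWeight_cons, he, hs], fun ω H => hs ?_⟩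
        rw [← H p (by simp), ← H q (by simp), he]
    · rcases hq with ⟨L', h1, h2, h3⟩ | ⟨h1, h2⟩
      · refine Or.inl ⟨q :: L', ?_, ?_, fun ω => ?_⟩
        · refine List.pairwise_cons.2 ⟨fun r hr => ?_, h1⟩
          rcases List.mem_cons.1 hr with rfl | hr
          · exact hlt
          · exact hlt.trans ((List.pairwise_cons.1 h1).1 r hr)
        · rw [pathWeight_cons, pathWeight_cons, h2]
        · rw [List.forall_mem_cons, List.forall_mem_cons (a := p) (l := q :: L'), h3]
      · refine Or.inr ⟨by rw [pathWeight_cons, h1, mul_zero], fun ω H => h2 ω fun r hr => ?_⟩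
        exact H r (List.mem_cons_of_mem _ hr)

theorem IsCTMC.measureReal_list (hX : IsCTMC μ Q X) (p : ℝ≥0 × Fin h)
    (L : List (ℝ≥0 × Fin h)) (hL : (p :: L).Pairwise fun a b => a.1 ≤ b.1) :
    μ.real {ω | ∀ q ∈ p :: L, X q.1 ω = q.2} =
      μ.real {ω | X p.1 ω = p.2} * pathWeight Q p L := by
  rcases exists_strict_list Q X p L hL with ⟨L', h1, h2, h3⟩ | ⟨h1, h2⟩
  · rw [h2, ← hX.measureReal_list_of_lt p L' h1]
    simp only [h3]
  · rw [h1, mul_zero]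
    simp only [h2, Set.ofPred_false, measureReal_empty]

theorem IsCTMC.measureReal_pair (hX : IsCTMC μ Q X) {u v : ℝ≥0} (huv : u ≤ v) (i j : Fin h) :
    μ.real {ω | X u ω = i ∧ X v ω = j} =
      μ.real {ω | X u ω = i} * transitionMatrix Q ((v : ℝ) - u) i j := by
  simpa [pathWeight] using hX.measureReal_list (u, i) [(v, j)] (by simpa using huv)

/-- The point is that `C` does not depend on `M`: it collects the factors up to `p` and after `q`.
The case `A = []` is separate because the initial law then enters at `p`. -/
theorem IsCTMC.exists_measureReal_bridge (hX : IsCTMC μ Q X) (A B : List (ℝ≥0 × Fin h))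
    (p q : ℝ≥0 × Fin h) : ∃ C : ℝ, ∀ M : List (ℝ≥0 × Fin h),
      ((A ++ p :: (M ++ q :: B)).Pairwise fun a b => a.1 ≤ b.1) →
      μ.real {ω | ∀ r ∈ A ++ p :: (M ++ q :: B), X r.1 ω = r.2} =
        C * pathWeight Q p (M ++ [q]) := by
  rcases A with _ | ⟨a, A⟩
  · refine ⟨μ.real {ω | X p.1 ω = p.2} * pathWeight Q q B, fun M hM => ?_⟩
    rw [List.nil_append] at hM ⊢
    rw [hX.measureReal_list _ _ hM, pathWeight_append_cons]
    ring
  · refine ⟨μ.real {ω | X a.1 ω = a.2} * pathWeight Q a (A ++ [p]) * pathWeight Q q B,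
      fun M hM => ?_⟩
    rw [List.cons_append] at hM ⊢
    rw [hX.measureReal_list _ _ hM, pathWeight_append_cons, pathWeight_append_cons p q]
    ring

theorem IsCTMC.exists_measureReal_inter (hX : IsCTMC μ Q X) {m : ℕ} {t : Fin (m + 1) → ℝ≥0}
    (ht : StrictMono t) (y : Fin (m + 1) → Fin h) (s : Fin m) : ∃ C : ℝ, ∀ u v : ℝ≥0,
      t s.castSucc ≤ u → u ≤ v → v ≤ t s.succ → ∀ i j,
      μ.real ({ω | ∀ s, X (t s) ω = y s} ∩ {ω | X u ω = i ∧ X v ω = j}) =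
        C * (transitionMatrix Q ((u : ℝ) - t s.castSucc) (y s.castSucc) i *
          (transitionMatrix Q ((v : ℝ) - u) i j *
            transitionMatrix Q ((t s.succ : ℝ) - v) j (y s.succ))) := by
  set L : List (ℝ≥0 × Fin h) := List.ofFn fun k => (t k, y k) with hL
  have hlen : L.length = m + 1 := by simp [hL]
  have hsplit : L = L.take s ++ (t s.castSucc, y s.castSucc) :: (t s.succ, y s.succ) ::
      L.drop (s + 2) := by
    have h1 : (s : ℕ) < L.length := by omega
    have h2 : (s : ℕ) + 1 < L.length := by omega
    conv_lhs => rw [← List.take_append_drop s L, List.drop_eq_getElem_cons h1,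
      List.drop_eq_getElem_cons h2]
    simp [hL, -List.ofFn_succ, Fin.castSucc, Fin.succ, Fin.castAdd, Fin.castLE]
  have hsorted : L.Pairwise fun a b => a.1 ≤ b.1 := by
    rw [hL, List.pairwise_ofFn]
    exact fun i j hij => (ht hij).le
  have hmem : ∀ ω, (∀ r ∈ L, X r.1 ω = r.2) ↔ ∀ s, X (t s) ω = y s := fun ω => by
    simp only [hL, List.forall_mem_ofFn_iff]
  obtain ⟨C, hC⟩ := hX.exists_measureReal_bridge (L.take s) (L.drop (s + 2))
    (t s.castSucc, y s.castSucc) (t s.succ, y s.succ)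
  generalize L.take s = A at hsplit hC
  generalize L.drop (s + 2) = B at hsplit hC
  refine ⟨C, fun u v hu huv hv i j => ?_⟩
  have := hC [(u, i), (v, j)] (by
    rw [hsplit] at hsorted
    simp only [List.pairwise_append, List.pairwise_cons, List.mem_cons, List.cons_append,
      List.nil_append, forall_eq_or_imp] at hsorted ⊢
    obtain ⟨hA, ⟨⟨-, hpB⟩, hqB, hB⟩, hAB⟩ := hsorted
    exact ⟨hA, ⟨⟨hu, hu.trans huv, hu.trans (huv.trans hv), hpB⟩, ⟨huv, huv.trans hv,
      fun r hr => (huv.trans hv).trans (hqB r hr)⟩, ⟨hv, fun r hr => hv.trans (hqB r hr)⟩, hqB, hB⟩,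
      fun a ha => ⟨(hAB a ha).1, (hAB a ha).1.trans hu, (hAB a ha).1.trans (hu.trans huv),
        (hAB a ha).2⟩⟩)
  simp only [pathWeight, List.cons_append, List.nil_append, mul_one] at this
  rw [← this]
  congr 1
  ext ω
  have hω := hmem ω
  rw [hsplit] at hω
  change (∀ s, X (t s) ω = y s) ∧ (X u ω = i ∧ X v ω = j) ↔
    ∀ r ∈ A ++ _ :: _ :: _ :: _ :: B, X (Prod.fst r) ω = Prod.snd r
  rw [← hω]
  simp only [List.forall_mem_append, List.forall_mem_cons]
  tauto

end Markov

/-! ### Integrals of dyadic sums and passage to the limit. -/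

section Expectation

variable {Ω : Type*} [MeasurableSpace Ω] {μ : Measure Ω} {h : ℕ} {Q : Matrix (Fin h) (Fin h) ℝ}
  {X : ℝ≥0 → Ω → Fin h}

theorem measurable_dyadicFunctional (hm : ∀ u, Measurable (X u)) (w : ℝ → Fin h → Fin h → ℝ)
    (k : ℕ) (a b : ℝ≥0) : Measurable (dyadicFunctional w X k a b) := by
  induction k generalizing a b with
  | zero =>
    exact (measurable_of_countable (fun p : Fin h × Fin h =>
      ENNReal.ofReal (w ((b : ℝ) - a) p.1 p.2))).comp ((hm a).prodMk (hm b))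
  | succ k ih => exact (ih _ _).add (ih _ _)

theorem measurable_switchCount (hm : ∀ u, Measurable (X u)) (k : ℕ) (a b : ℝ≥0) :
    Measurable fun ω => (switchCount (fun u => X u ω) k a b : ℝ≥0∞) := by
  suffices H : Measurable fun ω => switchCount (fun u => X u ω) k a b from
    (measurable_of_countable (fun n : ℕ => (n : ℝ≥0∞))).comp H
  induction k generalizing a b with
  | zero =>
    exact (measurable_of_countable (fun p : Fin h × Fin h => if p.1 = p.2 then 0 else 1)).comp
      ((hm a).prodMk (hm b))
  | succ k ih => exact (ih _ _).add (ih _ _)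

theorem setLIntegral_pair (hm : ∀ u, Measurable (X u)) (E : Set Ω) (g : Fin h → Fin h → ℝ≥0∞)
    (u v : ℝ≥0) : ∫⁻ ω in E, g (X u ω) (X v ω) ∂μ =
      ∑ i, ∑ j, g i j * μ (E ∩ {ω | X u ω = i ∧ X v ω = j}) := by
  have hp : Measurable fun ω => (X u ω, X v ω) := (hm u).prodMk (hm v)
  have h1 := lintegral_map (μ := μ.restrict E)
    (measurable_of_countable fun p : Fin h × Fin h => g p.1 p.2) hp
  rw [← h1, lintegral_fintype, Fintype.sum_prod_type]
  refine Finset.sum_congr rfl fun i _ => Finset.sum_congr rfl fun j _ => ?_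
  rw [Measure.map_apply hp (measurableSet_singleton _),
    Measure.restrict_apply (hp (measurableSet_singleton _)), Set.inter_comm]
  congr 2
  ext ω
  simp [Prod.ext_iff]

/-- Bounding the probability of the state at the left endpoint by `1` makes the estimate the same
for all pieces of equal length, so each halving just doubles it. -/
theorem IsCTMC.lintegral_switchCount_le [IsProbabilityMeasure μ] (hQ : IsGenerator Q)
    (hX : IsCTMC μ Q X) (k : ℕ) {p q : ℝ≥0} (hpq : p ≤ q) :
    ∫⁻ ω, switchCount (fun u => X u ω) k p q ∂μ ≤ 2 ^ k * ENNReal.ofReal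
      (∑ i, ∑ j, if i = j then 0 else transitionMatrix Q (((q : ℝ) - p) / 2 ^ k) i j) := by
  induction k generalizing p q with
  | zero =>
    have h0 : (0 : ℝ) ≤ q - p := sub_nonneg.2 (NNReal.coe_le_coe.2 hpq)
    have h1 := setLIntegral_pair (μ := μ) hX.measurable Set.univ
      (fun i j => ((if i = j then 0 else 1 : ℕ) : ℝ≥0∞)) p q
    rw [Measure.restrict_univ] at h1
    simp only [switchCount_zero]
    rw [h1, pow_zero, one_mul, pow_zero, div_one,
      ENNReal.ofReal_sum_of_nonneg fun i _ => Finset.sum_nonneg fun j _ => ?_]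
    · refine Finset.sum_le_sum fun i _ => ?_
      rw [ENNReal.ofReal_sum_of_nonneg fun j _ => ?_]
      · refine Finset.sum_le_sum fun j _ => ?_
        split_ifs
        · simp
        · rw [Nat.cast_one, one_mul, Set.univ_inter, ← ofReal_measureReal, hX.measureReal_pair hpq]
          refine ENNReal.ofReal_le_ofReal ?_
          exact mul_le_of_le_one_left (transitionMatrix_nonneg hQ h0 i j) measureReal_le_one
      · split_ifs
        · exact le_rfl
        · exact transitionMatrix_nonneg hQ h0 i j
    · split_ifs
      · exact le_rfl
      · exact transitionMatrix_nonneg hQ h0 i j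
  | succ k ih =>
    have h1 := ih (NNReal.le_midpoint hpq)
    have h2 := ih (NNReal.midpoint_le hpq)
    rw [NNReal.coe_midpoint_sub_left, div_div, ← pow_succ'] at h1
    rw [NNReal.coe_right_sub_midpoint, div_div, ← pow_succ'] at h2
    simp only [switchCount_succ, Nat.cast_add]
    rw [lintegral_add_left (measurable_switchCount hX.measurable k p _), pow_succ, mul_two, add_mul]
    exact add_le_add h1 h2

/-- `G` is the supremum over the levels. By monotone convergence its integral is the supremum of the
expected counts, bounded because `2^k P_ij(T / 2^k)` converges to `T q_ij` for `i ≠ j`. -/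
theorem IsCTMC.exists_integrable_bound_switchCount [IsProbabilityMeasure μ] (hQ : IsGenerator Q)
    (hX : IsCTMC μ Q X) {a b : ℝ≥0} (hab : a ≤ b) :
    ∃ G : Ω → ℝ≥0∞, Measurable G ∧ ∫⁻ ω, G ω ∂μ ≠ ∞ ∧
      ∀ k ω, (switchCount (fun u => X u ω) k a b : ℝ≥0∞) ≤ G ω := by
  have hmeas := fun k => measurable_switchCount hX.measurable k a b
  refine ⟨fun ω => ⨆ k, (switchCount (fun u => X u ω) k a b : ℝ≥0∞), .iSup hmeas, ?_,
    fun k ω => le_iSup (fun k => (switchCount (fun u => X u ω) k a b : ℝ≥0∞)) k⟩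
  rw [lintegral_iSup hmeas fun k l hkl ω => Nat.cast_le.2 (monotone_switchCount _ a b hkl)]
  have hlim : Tendsto (fun k : ℕ => ∑ i, ∑ j, 2 ^ k * if i = j then 0 else
      transitionMatrix Q (((b : ℝ) - a) / 2 ^ k) i j) atTop
      (𝓝 (∑ i, ∑ j, if i = j then 0 else ((b : ℝ) - a) * Q i j)) := by
    refine tendsto_finsetSum _ fun i _ => tendsto_finsetSum _ fun j _ => ?_
    split_ifs with hij
    · simp
    · simpa [Matrix.one_apply_ne hij] using
        tendsto_two_pow_mul_transitionMatrix_sub Q ((b : ℝ) - a) i j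
  obtain ⟨B, hB⟩ := hlim.bddAbove_range
  refine ne_top_of_le_ne_top ENNReal.ofReal_ne_top (b := ENNReal.ofReal B) (iSup_le fun k => ?_)
  refine (hX.lintegral_switchCount_le hQ k hab).trans ?_
  have h2 : (2 : ℝ≥0∞) ^ k = ENNReal.ofReal (2 ^ k) := by
    rw [ENNReal.ofReal_pow zero_le_two, ENNReal.ofReal_ofNat]
  rw [h2, ← ENNReal.ofReal_mul (by positivity)]
  refine ENNReal.ofReal_le_ofReal (le_trans (le_of_eq ?_) (hB ⟨k, rfl⟩))
  simp only [Finset.mul_sum]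

theorem IsCTMC.ae_right_continuous (hX : IsCTMC μ Q X) :
    ∀ᵐ ω ∂μ, ∀ u, ∃ c > u, ∀ v ∈ Set.Ico u c, X v ω = X u ω := by
  filter_upwards [hX.right_continuous] with ω hω u
  have h1 : ∀ᶠ v in 𝓝[≥] u, X v ω = X u ω := (hω u) (mem_nhds_discrete.2 (Set.mem_singleton _))
  obtain ⟨c, hc, hc'⟩ := mem_nhdsGE_iff_exists_Ico_subset.1 h1
  exact ⟨c, hc, fun v hv => hc' hv⟩

/-- The subinterval `[p, q]` varies so that the induction can pass to halves; the semigroup property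
reassembles them. Nonnegativity is carried along because the sign of `C` is not given and
`ENNReal.ofReal` is additive only on nonnegative terms. -/
theorem setLIntegral_dyadicFunctional [IsFiniteMeasure μ] (hm : ∀ u, Measurable (X u)) {E : Set Ω}
    {a b : ℝ≥0} {x z : Fin h} {C : ℝ} (hE : ∀ u v : ℝ≥0, a ≤ u → u ≤ v → v ≤ b → ∀ i j,
      μ.real (E ∩ {ω | X u ω = i ∧ X v ω = j}) = C * (transitionMatrix Q ((u : ℝ) - a) x i *
        (transitionMatrix Q ((v : ℝ) - u) i j * transitionMatrix Q ((b : ℝ) - v) j z)))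
    {w : ℝ → Fin h → Fin h → ℝ} (hw : ∀ d, 0 ≤ d → ∀ i j, 0 ≤ w d i j) (k : ℕ) {p q : ℝ≥0}
    (hap : a ≤ p) (hpq : p ≤ q) (hqb : q ≤ b) :
    ∫⁻ ω in E, dyadicFunctional w X k p q ω ∂μ = ENNReal.ofReal (C * (transitionMatrix Q (p - a) *
        weightedTransition Q w k (q - p) * transitionMatrix Q (b - q)) x z) ∧
      0 ≤ C * (transitionMatrix Q (p - a) *
        weightedTransition Q w k (q - p) * transitionMatrix Q (b - q)) x z := by
  induction k generalizing p q with
  | zero =>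
    have hd : (0 : ℝ) ≤ q - p := sub_nonneg.2 (NNReal.coe_le_coe.2 hpq)
    have hsum : C * (transitionMatrix Q (p - a) * weightedTransition Q w 0 (q - p) *
        transitionMatrix Q (b - q)) x z =
        ∑ i, ∑ j, w (q - p) i j * μ.real (E ∩ {ω | X p ω = i ∧ X q ω = j}) := by
      rw [Matrix.mul_apply, Finset.mul_sum, Finset.sum_comm]
      refine Finset.sum_congr rfl fun j _ => ?_
      rw [Matrix.mul_apply, Finset.sum_mul, Finset.mul_sum]
      refine Finset.sum_congr rfl fun i _ => ?_
      rw [hE p q hap hpq hqb]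
      simp only [weightedTransition, Matrix.of_apply]
      ring
    have hnn : ∀ i j, 0 ≤ w (q - p) i j * μ.real (E ∩ {ω | X p ω = i ∧ X q ω = j}) :=
      fun i j => mul_nonneg (hw _ hd i j) measureReal_nonneg
    rw [hsum]
    refine ⟨?_, Finset.sum_nonneg fun i _ => Finset.sum_nonneg fun j _ => hnn i j⟩
    simp only [dyadicFunctional_zero]
    rw [setLIntegral_pair hm E (fun i j => ENNReal.ofReal (w (q - p) i j)),
      ENNReal.ofReal_sum_of_nonneg fun i _ => Finset.sum_nonneg fun j _ => hnn i j]
    refine Finset.sum_congr rfl fun i _ => ?_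
    rw [ENNReal.ofReal_sum_of_nonneg fun j _ => hnn i j]
    refine Finset.sum_congr rfl fun j _ => ?_
    rw [ENNReal.ofReal_mul (hw _ hd i j), ofReal_measureReal]
  | succ k ih =>
    obtain ⟨h1, h1'⟩ := ih hap (NNReal.le_midpoint hpq) ((NNReal.midpoint_le hpq).trans hqb)
    obtain ⟨h2, h2'⟩ := ih (hap.trans (NNReal.le_midpoint hpq)) (NNReal.midpoint_le hpq) hqb
    have e1 : (b : ℝ) - ((p + q) / 2 : ℝ≥0) = (q - p) / 2 + (b - q) := by push_cast; ring
    have e2 : (((p + q) / 2 : ℝ≥0) : ℝ) - a = (p - a) + (q - p) / 2 := by push_cast; ring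
    have hsum : C * (transitionMatrix Q (p - a) * weightedTransition Q w (k + 1) (q - p) *
          transitionMatrix Q (b - q)) x z =
        C * (transitionMatrix Q (p - a) *
          weightedTransition Q w k (((p + q) / 2 : ℝ≥0) - p) *
            transitionMatrix Q (b - ((p + q) / 2 : ℝ≥0))) x z +
        C * (transitionMatrix Q (((p + q) / 2 : ℝ≥0) - a) *
          weightedTransition Q w k (q - ((p + q) / 2 : ℝ≥0)) *
            transitionMatrix Q (b - q)) x z := by
      rw [NNReal.coe_midpoint_sub_left, NNReal.coe_right_sub_midpoint, e1, e2,
        transitionMatrix_add, transitionMatrix_add, ← mul_add, ← Matrix.add_apply,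
        weightedTransition]
      simp only [Matrix.mul_add, Matrix.add_mul, Matrix.mul_assoc]
    rw [hsum]
    refine ⟨?_, add_nonneg h1' h2'⟩
    simp only [dyadicFunctional_succ]
    rw [lintegral_add_left (measurable_dyadicFunctional hm w k _ _), h1, h2,
      ENNReal.ofReal_add h1' h2']

/-- `F` is not assumed measurable: it is an almost everywhere limit of measurable dyadic sums. -/
theorem setLIntegral_eq_of_tendsto_dyadicFunctional [IsFiniteMeasure μ]
    (hm : ∀ u, Measurable (X u)) {E : Set Ω} {a b : ℝ≥0} (hab : a ≤ b) {x z : Fin h} {C : ℝ}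
    (hE : ∀ u v : ℝ≥0, a ≤ u → u ≤ v → v ≤ b → ∀ i j,
      μ.real (E ∩ {ω | X u ω = i ∧ X v ω = j}) = C * (transitionMatrix Q ((u : ℝ) - a) x i *
        (transitionMatrix Q ((v : ℝ) - u) i j * transitionMatrix Q ((b : ℝ) - v) j z)))
    {w : ℝ → Fin h → Fin h → ℝ} (hw : ∀ d, 0 ≤ d → ∀ i j, 0 ≤ w d i j)
    {V : Matrix (Fin h) (Fin h) ℝ} (hV : ∀ i j, Tendsto (fun k : ℕ =>
      2 ^ k * (w ((b - a) / 2 ^ k) i j * transitionMatrix Q ((b - a) / 2 ^ k) i j)) atTop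
        (𝓝 ((b - a) * V i j)))
    {F G : Ω → ℝ≥0∞} (hG : ∫⁻ ω, G ω ∂μ ≠ ∞) (hFG : ∀ k ω, dyadicFunctional w X k a b ω ≤ G ω)
    (hF : ∀ᵐ ω ∂μ, Tendsto (fun k => dyadicFunctional w X k a b ω) atTop (𝓝 (F ω))) :
    AEMeasurable F μ ∧ ∫⁻ ω in E, F ω ∂μ = ENNReal.ofReal
      (C * NormedSpace.exp (((b : ℝ) - a) • Matrix.fromBlocks Q V 0 Q) (Sum.inl x) (Sum.inr z)) ∧
    0 ≤ C * NormedSpace.exp (((b : ℝ) - a) • Matrix.fromBlocks Q V 0 Q)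
      (Sum.inl x) (Sum.inr z) := by
  have h1 := fun k => setLIntegral_dyadicFunctional hm hE hw k le_rfl hab le_rfl
  simp only [sub_self, transitionMatrix_zero, one_mul, mul_one] at h1
  have h2 := (tendsto_weightedTransition Q w V _ hV x z).const_mul C
  refine ⟨aemeasurable_of_tendsto_metrizable_ae atTop
    (fun k => (measurable_dyadicFunctional hm w k a b).aemeasurable) hF, ?_,
    ge_of_tendsto' h2 fun k => (h1 k).2⟩
  have h3 := tendsto_lintegral_of_dominated_convergence (μ := μ.restrict E) G
    (fun k => measurable_dyadicFunctional hm w k a b) (fun k => ae_of_all _ (hFG k))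
    (ne_top_of_le_ne_top hG (setLIntegral_le_lintegral E G)) (ae_restrict_of_ae hF)
  simp only [fun k => (h1 k).1] at h3
  exact tendsto_nhds_unique h3 (ENNReal.tendsto_ofReal h2)

end Expectation

/-! ### Conditioning on the observations. -/

section Conditional

variable {Ω : Type*} [MeasurableSpace Ω] {μ : Measure Ω} [IsProbabilityMeasure μ] {h : ℕ}
  {Q : Matrix (Fin h) (Fin h) ℝ} {X : ℝ≥0 → Ω → Fin h} {m : ℕ} {t : Fin (m + 1) → ℝ≥0}
  {y : Fin (m + 1) → Fin h}

theorem IsCTMC.exists_bridge_const (hQ : IsGenerator Q) (hX : IsCTMC μ Q X) (ht : StrictMono t)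
    (hy : μ {ω | ∀ s, X (t s) ω = y s} ≠ 0) (s : Fin m) : ∃ C : ℝ, 0 < C ∧
      0 < transitionMatrix Q ((t s.succ : ℝ) - t s.castSucc) (y s.castSucc) (y s.succ) ∧
      μ {ω | ∀ s, X (t s) ω = y s} = ENNReal.ofReal
        (C * transitionMatrix Q ((t s.succ : ℝ) - t s.castSucc) (y s.castSucc) (y s.succ)) ∧
      ∀ u v : ℝ≥0, t s.castSucc ≤ u → u ≤ v → v ≤ t s.succ → ∀ i j,
        μ.real ({ω | ∀ s, X (t s) ω = y s} ∩ {ω | X u ω = i ∧ X v ω = j}) =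
          C * (transitionMatrix Q ((u : ℝ) - t s.castSucc) (y s.castSucc) i *
            (transitionMatrix Q ((v : ℝ) - u) i j *
              transitionMatrix Q ((t s.succ : ℝ) - v) j (y s.succ))) := by
  obtain ⟨C, hC⟩ := hX.exists_measureReal_inter ht y s
  have hlt : t s.castSucc < t s.succ := ht Fin.castSucc_lt_succ
  -- With `u = v = t_s` and `i = j = y_s` the extra event is implied by the observations, so the
  -- formula gives the probability of the observation event itself. Its positivity makes both
  -- factors positive.
  have h1 := hC (t s.castSucc) (t s.castSucc) le_rfl le_rfl hlt.le (y s.castSucc) (y s.castSucc)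
  have hsub : {ω | ∀ s, X (t s) ω = y s} ⊆
      {ω | X (t s.castSucc) ω = y s.castSucc ∧ X (t s.castSucc) ω = y s.castSucc} :=
    fun ω hω => ⟨hω s.castSucc, hω s.castSucc⟩
  rw [Set.inter_eq_left.2 hsub] at h1
  simp only [sub_self, transitionMatrix_zero, Matrix.one_apply_eq, one_mul] at h1
  have hpos : 0 < μ.real {ω | ∀ s, X (t s) ω = y s} :=
    ENNReal.toReal_pos hy (measure_ne_top _ _)
  have hP := transitionMatrix_nonneg hQ (sub_nonneg.2 (NNReal.coe_le_coe.2 hlt.le))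
    (y s.castSucc) (y s.succ)
  rw [h1] at hpos
  refine ⟨C, pos_of_mul_pos_left hpos hP, pos_of_mul_pos_right hpos
    (pos_of_mul_pos_left hpos hP).le, ?_, hC⟩
  rw [← h1, ofReal_measureReal]

/-- Common form of both formulas. In `hbound` the switch count dominates the jump sums and the
interval length dominates the holding sums. -/
theorem IsCTMC.lintegral_cond_functional (hQ : IsGenerator Q) (hX : IsCTMC μ Q X)
    (ht : StrictMono t) (hy : μ {ω | ∀ s, X (t s) ω = y s} ≠ 0)
    {w : ℝ → Fin h → Fin h → ℝ} (hw : ∀ d, 0 ≤ d → ∀ i j, 0 ≤ w d i j)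
    {V : Matrix (Fin h) (Fin h) ℝ} (hV : ∀ (T : ℝ) i j, Tendsto (fun k : ℕ =>
      2 ^ k * (w (T / 2 ^ k) i j * transitionMatrix Q (T / 2 ^ k) i j)) atTop (𝓝 (T * V i j)))
    {F : ℝ≥0 → ℝ≥0 → Ω → ℝ≥0∞} (hF0 : ∀ ω a, F a a ω = 0)
    (hFadd : ∀ ω a b c, a ≤ b → b ≤ c → F a c ω = F a b ω + F b c ω)
    (hF : ∀ ω, (∀ u, ∃ c > u, ∀ v ∈ Set.Ico u c, X v ω = X u ω) → ∀ a b, a < b → ∀ N : ℕ,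
      (∀ k, switchCount (fun u => X u ω) k a b ≤ N) →
      Tendsto (fun k => dyadicFunctional w X k a b ω) atTop (𝓝 (F a b ω)))
    (hbound : ∀ ω k a b, a ≤ b → dyadicFunctional w X k a b ω ≤
      switchCount (fun u => X u ω) k a b + ENNReal.ofReal (b - a)) :
    AEMeasurable (F (t 0) (t (Fin.last m))) μ ∧
    ∫⁻ ω, F (t 0) (t (Fin.last m)) ω ∂μ[|{ω | ∀ s, X (t s) ω = y s}] ≠ ∞ ∧
    (∫⁻ ω, F (t 0) (t (Fin.last m)) ω ∂μ[|{ω | ∀ s, X (t s) ω = y s}]).toReal =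
      ∑ s : Fin m, NormedSpace.exp (((t s.succ : ℝ) - t s.castSucc) • Matrix.fromBlocks Q V 0 Q)
          (Sum.inl (y s.castSucc)) (Sum.inr (y s.succ)) /
        transitionMatrix Q ((t s.succ : ℝ) - t s.castSucc) (y s.castSucc) (y s.succ) := by
  set E : Set Ω := {ω | ∀ s, X (t s) ω = y s} with hE
  set e : Fin m → ℝ := fun s => NormedSpace.exp (((t s.succ : ℝ) - t s.castSucc) •
    Matrix.fromBlocks Q V 0 Q) (Sum.inl (y s.castSucc)) (Sum.inr (y s.succ)) /
      transitionMatrix Q ((t s.succ : ℝ) - t s.castSucc) (y s.castSucc) (y s.succ) with he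
  have hpiece : ∀ s : Fin m, AEMeasurable (F (t s.castSucc) (t s.succ)) μ ∧
      ∫⁻ ω, F (t s.castSucc) (t s.succ) ω ∂μ[|E] = ENNReal.ofReal (e s) ∧ 0 ≤ e s := by
    intro s
    obtain ⟨C, hC, hP, hμE, hbridge⟩ := hX.exists_bridge_const hQ ht hy s
    have hlt : t s.castSucc < t s.succ := ht Fin.castSucc_lt_succ
    obtain ⟨G, hGm, hG, hGle⟩ := hX.exists_integrable_bound_switchCount hQ hlt.le
    have hlim : ∀ᵐ ω ∂μ, Tendsto (fun k => dyadicFunctional w X k (t s.castSucc) (t s.succ) ω)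
        atTop (𝓝 (F (t s.castSucc) (t s.succ) ω)) := by
      filter_upwards [hX.ae_right_continuous, ae_lt_top hGm hG] with ω h1 h2
      obtain ⟨N, hN⟩ := ENNReal.exists_nat_gt h2.ne
      exact hF ω h1 _ _ hlt N fun k => Nat.cast_le.1 ((hGle k ω).trans hN.le)
    have hG' : ∫⁻ ω, G ω + ENNReal.ofReal ((t s.succ : ℝ) - t s.castSucc) ∂μ ≠ ∞ := by
      rw [lintegral_add_left hGm, lintegral_const, measure_univ, mul_one]
      exact ENNReal.add_ne_top.2 ⟨hG, ENNReal.ofReal_ne_top⟩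
    obtain ⟨h1, h2, h3⟩ := setLIntegral_eq_of_tendsto_dyadicFunctional hX.measurable hlt.le hbridge
      hw (hV _) hG' (fun k ω => (hbound ω k _ _ hlt.le).trans (by gcongr; exact hGle k ω)) hlim
    refine ⟨h1, ?_, div_nonneg ((mul_nonneg_iff_of_pos_left hC).1 h3) hP.le⟩
    -- Conditioning divides by `C` times the transition probability, and `C` cancels.
    rw [ProbabilityTheory.cond, lintegral_smul_measure, h2, hμE, smul_eq_mul,
      ← ENNReal.ofReal_inv_of_pos (mul_pos hC hP),
      ← ENNReal.ofReal_mul (inv_nonneg.2 (mul_pos hC hP).le)]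
    congr 1
    rw [he]
    field_simp
  have hsum : F (t 0) (t (Fin.last m)) = fun ω => ∑ s : Fin m, F (t s.castSucc) (t s.succ) ω :=
    funext fun ω => sum_eq_of_additive (F := fun a b => F a b ω) (hF0 ω) (hFadd ω) ht.monotone
  have hint : ∫⁻ ω, F (t 0) (t (Fin.last m)) ω ∂μ[|E] = ENNReal.ofReal (∑ s, e s) := by
    rw [hsum, lintegral_finsetSum' _ fun s _ => (hpiece s).1.mono_ac cond_absolutelyContinuous,
      ENNReal.ofReal_sum_of_nonneg fun s _ => (hpiece s).2.2]
    exact Finset.sum_congr rfl fun s _ => (hpiece s).2.1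
  refine ⟨?_, ?_, ?_⟩
  · rw [hsum]
    exact Finset.aemeasurable_fun_sum _ fun s _ => (hpiece s).1
  · rw [hint]
    exact ENNReal.ofReal_ne_top
  · rw [hint, ENNReal.toReal_ofReal (Finset.sum_nonneg fun s _ => (hpiece s).2.2)]

theorem tendsto_jumpWeight_mul_transitionMatrix (Q : Matrix (Fin h) (Fin h) ℝ) {i j : Fin h}
    (hij : i ≠ j) (T : ℝ) (a b : Fin h) : Tendsto (fun k : ℕ =>
      2 ^ k * (jumpWeight i j (T / 2 ^ k) a b * transitionMatrix Q (T / 2 ^ k) a b)) atTop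
      (𝓝 (T * (Q i j • Matrix.vecMulVec (Pi.single i (1 : ℝ)) (Pi.single j 1)) a b)) := by
  by_cases hab : a = i ∧ b = j
  · obtain ⟨rfl, rfl⟩ := hab
    simpa [jumpWeight, Matrix.vecMulVec_apply, Matrix.one_apply_ne hij] using
      tendsto_two_pow_mul_transitionMatrix_sub Q T a b
  · have : (Pi.single i (1 : ℝ) : Fin h → ℝ) a * (Pi.single j (1 : ℝ) : Fin h → ℝ) b = 0 := by
      rcases not_and_or.1 hab with hne | hne <;> simp [hne]
    simp [jumpWeight, hab, Matrix.vecMulVec_apply, this]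

/-- The weight already carries the factor `T / 2^k`, so only the limit `1` of the transition
matrices enters, not their derivative `Q`. -/
theorem tendsto_holdingWeight_mul_transitionMatrix (Q : Matrix (Fin h) (Fin h) ℝ) (i : Fin h)
    (T : ℝ) (a b : Fin h) : Tendsto (fun k : ℕ =>
      2 ^ k * (holdingWeight i (T / 2 ^ k) a b * transitionMatrix Q (T / 2 ^ k) a b)) atTop
      (𝓝 (T * Matrix.vecMulVec (Pi.single i (1 : ℝ)) (Pi.single i 1) a b)) := by
  by_cases ha : a = i
  · subst ha
    have h1 := (tendsto_transitionMatrix_div_two_pow Q T a b).const_mul T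
    have e : Matrix.vecMulVec (Pi.single a (1 : ℝ)) (Pi.single a 1) a b =
        (1 : Matrix (Fin h) (Fin h) ℝ) a b := by
      simp [Matrix.vecMulVec_apply, Pi.single_apply, Matrix.one_apply, eq_comm]
    rw [e]
    refine h1.congr fun k => ?_
    simp only [holdingWeight, if_true]
    field_simp
  · simp [holdingWeight, ha, Matrix.vecMulVec_apply]

end Conditional

theorem mainTheorem4 {Ω : Type*} [MeasurableSpace Ω] (μ : Measure Ω) [IsProbabilityMeasure μ]
    {h : ℕ} (Q : Matrix (Fin h) (Fin h) ℝ) (hQ : IsGenerator Q)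
    (X : ℝ≥0 → Ω → Fin h) (hX : IsCTMC μ Q X)
    -- the `n = m + 1` observation times
    (m : ℕ) (t : Fin (m + 1) → ℝ≥0) (ht : StrictMono t)
    -- the observed states, with a positive probability of being observed
    (y : Fin (m + 1) → Fin h) (hy : μ {ω | ∀ s, X (t s) ω = y s} ≠ 0) :
    (∀ s : Fin m, 0 <
      transitionMatrix Q ((t s.succ : ℝ) - t s.castSucc) (y s.castSucc) (y s.succ)) ∧
    (∀ i j : Fin h, i ≠ j →
      AEMeasurable (jumpCount X i j (t 0) (t (Fin.last m))) μ ∧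
      ∫⁻ ω, jumpCount X i j (t 0) (t (Fin.last m)) ω ∂μ[|{ω | ∀ s, X (t s) ω = y s}] ≠ ∞ ∧
      (∫⁻ ω, jumpCount X i j (t 0) (t (Fin.last m)) ω ∂μ[|{ω | ∀ s, X (t s) ω = y s}]).toReal =
        ∑ s : Fin m,
          NormedSpace.exp (((t s.succ : ℝ) - t s.castSucc) • Cgamma Q i j)
              (Sum.inl (y s.castSucc)) (Sum.inr (y s.succ)) /
            transitionMatrix Q ((t s.succ : ℝ) - t s.castSucc) (y s.castSucc) (y s.succ)) ∧
    (∀ i : Fin h,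
      AEMeasurable (holdingTime X i (t 0) (t (Fin.last m))) μ ∧
      ∫⁻ ω, holdingTime X i (t 0) (t (Fin.last m)) ω ∂μ[|{ω | ∀ s, X (t s) ω = y s}] ≠ ∞ ∧
      (∫⁻ ω, holdingTime X i (t 0) (t (Fin.last m)) ω ∂μ[|{ω | ∀ s, X (t s) ω = y s}]).toReal =
        ∑ s : Fin m,
          NormedSpace.exp (((t s.succ : ℝ) - t s.castSucc) • Cphi Q i)
              (Sum.inl (y s.castSucc)) (Sum.inr (y s.succ)) /
            transitionMatrix Q ((t s.succ : ℝ) - t s.castSucc) (y s.castSucc) (y s.succ)) := by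

  refine ⟨fun s => (hX.exists_bridge_const hQ ht hy s).choose_spec.2.1, fun i j hij => ?_,
    fun i => ?_⟩
  · exact hX.lintegral_cond_functional hQ ht hy (w := jumpWeight i j) (F := jumpCount X i j)
      (fun d _ a b => by rw [jumpWeight]; split_ifs <;> norm_num)
      (tendsto_jumpWeight_mul_transitionMatrix Q hij) (fun ω a => jumpCount_self X i j a ω)
      (fun ω a b c hab hbc => jumpCount_add X i j hab hbc ω)
      (fun ω hω a b hab N hN => tendsto_dyadicFunctional_jumpWeight hω hij hab hN)
      (fun ω k a b _ => (dyadicFunctional_jumpWeight_le hij k a b).trans le_self_add)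
  · exact hX.lintegral_cond_functional hQ ht hy (w := holdingWeight i) (F := holdingTime X i)
      (fun d hd a b => by rw [holdingWeight]; split_ifs <;> simp [hd])
      (tendsto_holdingWeight_mul_transitionMatrix Q i) (fun ω a => holdingTime_self X i a ω)
      (fun ω a b c hab hbc => holdingTime_add X i hab hbc ω)
      (fun ω hω a b hab N hN => tendsto_dyadicFunctional_holdingWeight hω i hab hN)
      (fun ω k a b hab => (dyadicFunctional_holdingWeight_le i k hab).trans le_add_self)
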